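/- Let $\mathcal{P}$ be a Lie groupoid with manifold of objects $\mathcal{P}_0$, manifold of morphisms $\mathcal{P}_1$, source and target submersions $s,t:\mathcal{P}_1\to\mathcal{P}_0$, manifold $\mathcal{P}_2=\mathcal{P}_1\,{}_s\!\times_t\mathcal{P}_1$ of composable pairs and composition $c:\mathcal{P}_2\to\mathcal{P}_1$. On differential forms put $\Delta:=t^*-s^*:\Omega^*(\mathcal{P}_0)\to\Omega^*(\mathcal{P}_1)$ and $\Delta:=\mathrm{pr}_1^*-c^*+\mathrm{pr}_2^*:\Omega^*(\mathcal{P}_1)\to\Omega^*(\mathcal{P}_2)$. Let $\gamma=(\mathfrak{h},\mathfrak{g},t_*,\alpha_*)$ be a strict Lie 2-algebra: finite-dimensional real Lie algebras $\mathfrak{h},\mathfrak{g}$, a Lie algebra homomorphism $t_*:\mathfrak{h}\to\mathfrak{g}$ and a Lie algebra action $\alpha_*$ of $\mathfrak{g}$ on $\mathfrak{h}$ by derivations such that $\alpha_*(t_*(Y_1),Y_2)=[Y_1,Y_2]$ and $t_*(\alpha_*(X,Y))=[X,t_*(Y)]$. For $p\ge 0$ let $\Omega^p(\mathcal{P},\gamma)$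 be the real vector space of triples $\Psi=(\Psi^a,\Psi^b,\Psi^c)$ of smooth forms $\Psi^a\in\Omega^p(\mathcal{P}_0,\mathfrak{g})$, $\Psi^b\in\Omega^p(\mathcal{P}_1,\mathfrak{h})$, $\Psi^c\in\Omega^{p+1}(\mathcal{P}_0,\mathfrak{h})$ with $\Delta\Psi^a=t_*(\Psi^b)$ and $\Delta\Psi^b=0$. For $\Psi\in\Omega^p(\mathcal{P},\gamma)$ let $\mathrm{D}\Psi$ have the components $$(\mathrm{D}\Psi)^a=\mathrm{d}\Psi^a-(-1)^p t_*(\Psi^c),\qquad (\mathrm{D}\Psi)^b=\mathrm{d}\Psi^b-(-1)^p\Delta(\Psi^c),\qquad (\mathrm{D}\Psi)^c=\mathrm{d}\Psi^c,$$ and for $\Psi\in\Omega^k(\mathcal{P},\gamma)$, $\Phi\in\Omega^l(\mathcal{P},\gamma)$ let $[\Psi\wedge\Phi]$ have the components $$[\Psi\wedge\Phi]^a=[\Psi^a\wedge\Phi^a],$$ $$[\Psi\wedge\Phi]^b=[\Psi^b\wedge\Phi^b]+\alpha_*(s^*\Psi^a\wedge\Phi^b)-(-1)^{kl}\alpha_*(s^*\Phi^a\wedge\Psi^b),$$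 $$[\Psi\wedge\Phi]^c=\alpha_*(\Psi^a\wedge\Phi^c)-(-1)^{kl}\alpha_*(\Phi^a\wedge\Psi^c).$$ Then $\mathrm{D}$ is a well-defined linear map $\Omega^p(\mathcal{P},\gamma)\to\Omega^{p+1}(\mathcal{P},\gamma)$ with $\mathrm{D}^2=0$, the bracket is a well-defined bilinear map $\Omega^k(\mathcal{P},\gamma)\times\Omega^l(\mathcal{P},\gamma)\to\Omega^{k+l}(\mathcal{P},\gamma)$, and they form a differential graded Lie algebra: for all $\Psi\in\Omega^k(\mathcal{P},\gamma)$, $\Phi\in\Omega^l(\mathcal{P},\gamma)$, $\Xi\in\Omega^i(\mathcal{P},\gamma)$, (a) $[\Phi\wedge\Psi]=-(-1)^{kl}[\Psi\wedge\Phi]$; (b) $(-1)^{ki}[[\Psi\wedge\Phi]\wedge\Xi]+(-1)^{li}[[\Xi\wedge\Psi]\wedge\Phi]+(-1)^{kl}[[\Phi\wedge\Xi]\wedge\Psi]=0$; (c) $\mathrm{D}[\Psi\wedge\Phi]=[\mathrm{D}\Psi\wedge\Phi]+(-1)^k[\Psi\wedge\mathrm{D}\Phi]$. -/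

import Mathlib

open scoped Manifold ContDiff Topology

set_option linter.unusedSectionVars false

noncomputable section

namespace GForms

/-! ### The wedge product with respect to a bilinear map -/

section Wedge

/-- The wedge product of two alternating maps with respect to a bilinear map `B`: the sum over
`(p, q)`-shuffles `σ` of `sign σ • B (θ (v σ(1), …, v σ(p))) (η (v σ(p+1), …, v σ(p+q)))`,
that is, Mathlib's exterior product with values in a tensor product, followed by `B`. -/
def wedgeAlg {T V W U : Type*} [AddCommGroup T] [Module ℝ T] [AddCommGroup V] [Module ℝ V]
    [AddCommGroup W] [Module ℝ W] [AddCommGroup U] [Module ℝ U]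
    (B : V →ₗ[ℝ] W →ₗ[ℝ] U) {p q : ℕ} (θ : T [⋀^Fin p]→ₗ[ℝ] V) (η : T [⋀^Fin q]→ₗ[ℝ] W) :
    T [⋀^Fin (p + q)]→ₗ[ℝ] U :=
  ((TensorProduct.lift B).compAlternatingMap (θ.domCoprod η)).domDomCongr finSumFinEquiv

variable {T V W U : Type*} [AddCommGroup T] [Module ℝ T] [TopologicalSpace T]
  [NormedAddCommGroup V] [NormedSpace ℝ V] [FiniteDimensional ℝ V]
  [NormedAddCommGroup W] [NormedSpace ℝ W] [FiniteDimensional ℝ W]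
  [NormedAddCommGroup U] [NormedSpace ℝ U]

theorem continuous_wedgeAlg (B : V →ₗ[ℝ] W →ₗ[ℝ] U) {p q : ℕ}
    (θ : T [⋀^Fin p]→L[ℝ] V) (η : T [⋀^Fin q]→L[ℝ] W) :
    Continuous (wedgeAlg B θ.toAlternatingMap η.toAlternatingMap) := by
  have key : ∀ σ : Equiv.Perm.ModSumCongr (Fin p) (Fin q), Continuous fun v : Fin (p + q) → T =>
      TensorProduct.lift B (AlternatingMap.domCoprod.summand θ.toAlternatingMap
        η.toAlternatingMap σ (fun i => v (finSumFinEquiv i))) := by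
    intro σ
    induction σ using Quotient.inductionOn' with
    | h σ =>
      have h1 : Continuous fun v : Fin (p + q) → T =>
          θ (fun i => v (finSumFinEquiv (σ (Sum.inl i)))) := θ.cont.comp (by fun_prop)
      have h2 : Continuous fun v : Fin (p + q) → T =>
          η (fun i => v (finSumFinEquiv (σ (Sum.inr i)))) := η.cont.comp (by fun_prop)
      have h3 := (B.toContinuousBilinearMap.continuous.comp h1).clm_apply h2
      have h4 := h3.const_smul ((Equiv.Perm.sign σ : ℤˣ) : ℤ)
      refine h4.congr fun v => ?_
      rw [AlternatingMap.domCoprod.summand_mk'', Units.smul_def]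
      change _ = TensorProduct.lift B (((Equiv.Perm.sign σ : ℤˣ) : ℤ) •
        ((θ (fun i => v (finSumFinEquiv (σ (Sum.inl i))))) ⊗ₜ[ℝ]
          (η (fun i => v (finSumFinEquiv (σ (Sum.inr i)))))))
      rw [map_zsmul, TensorProduct.lift.tmul]
      rfl
  have h : (wedgeAlg B θ.toAlternatingMap η.toAlternatingMap : (Fin (p + q) → T) → U) =
      fun v => ∑ σ : Equiv.Perm.ModSumCongr (Fin p) (Fin q),
        TensorProduct.lift B (AlternatingMap.domCoprod.summand θ.toAlternatingMap
        η.toAlternatingMap σ (fun i => v (finSumFinEquiv i))) := by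
    funext v
    simp [wedgeAlg, AlternatingMap.domCoprod_apply]
    rfl
  rw [h]
  exact continuous_finsetSum _ fun σ _ => key σ

/-- The wedge product with respect to `B`, as a continuous alternating map. -/
def wedge (B : V →ₗ[ℝ] W →ₗ[ℝ] U) {p q : ℕ} (θ : T [⋀^Fin p]→L[ℝ] V) (η : T [⋀^Fin q]→L[ℝ] W) :
    T [⋀^Fin (p + q)]→L[ℝ] U :=
  { wedgeAlg B θ.toAlternatingMap η.toAlternatingMap with
    cont := continuous_wedgeAlg B θ η }

end Wedge

/-! ### Differential forms on a manifold with values in a vector space -/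

/-- A (not necessarily smooth) `p`-form on the manifold `M` modelled on `E`, with values in `V`. -/
abbrev PreForm (E : Type*) [NormedAddCommGroup E] [NormedSpace ℝ E]
    (M : Type*) [TopologicalSpace M] [ChartedSpace E M]
    (V : Type*) [NormedAddCommGroup V] [NormedSpace ℝ V] (p : ℕ) : Type _ :=
  ∀ x : M, TangentSpace 𝓘(ℝ, E) x [⋀^Fin p]→L[ℝ] V

namespace PreForm

variable {E : Type*} [NormedAddCommGroup E] [NormedSpace ℝ E]
  {M : Type*} [TopologicalSpace M] [ChartedSpace E M]
  {E' : Type*} [NormedAddCommGroup E'] [NormedSpace ℝ E']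
  {N : Type*} [TopologicalSpace N] [ChartedSpace E' N]
  {V : Type*} [NormedAddCommGroup V] [NormedSpace ℝ V]
  {W : Type*} [NormedAddCommGroup W] [NormedSpace ℝ W]
  {U : Type*} [NormedAddCommGroup U] [NormedSpace ℝ U] {p q : ℕ}

/-- The pullback of a form along a map. -/
def pullback (f : M → N) (θ : PreForm E' N V p) : PreForm E M V p :=
  fun x => (θ (f x)).compContinuousLinearMap (mfderiv 𝓘(ℝ, E) 𝓘(ℝ, E') f x)

/-- The expression of a form in a chart `e`: its pullback along `e.symm`, as a form on `E`. -/
def inChart (θ : PreForm E M V p) (e : OpenPartialHomeomorph M E) : E → E [⋀^Fin p]→L[ℝ] V :=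
  pullback (E := E) e.symm θ

/-- A form is smooth if its expression in every chart of the atlas is smooth. -/
def IsSmooth (θ : PreForm E M V p) : Prop :=
  ∀ e ∈ atlas E M, ContDiffOn ℝ ∞ (θ.inChart e) e.target

/-- The exterior derivative, computed at each point in the preferred chart around this point. -/
def extd (θ : PreForm E M V p) : PreForm E M V (p + 1) :=
  fun x => ContinuousAlternatingMap.compContinuousLinearMap
    (extDeriv (θ.inChart (chartAt E x)) (chartAt E x x) : E [⋀^Fin (p + 1)]→L[ℝ] V)
    (mfderiv 𝓘(ℝ, E) 𝓘(ℝ, E) (chartAt E x) x)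

/-- The wedge product of forms with respect to a bilinear map of the coefficients. -/
def wedge [FiniteDimensional ℝ V] [FiniteDimensional ℝ W] (B : V →ₗ[ℝ] W →ₗ[ℝ] U)
    (θ : PreForm E M V p) (η : PreForm E M W q) : PreForm E M U (p + q) :=
  fun x => GForms.wedge B (θ x) (η x)

/-- Application of a linear map to the values of a form. -/
def mapValues [FiniteDimensional ℝ V] (L : V →ₗ[ℝ] W) (θ : PreForm E M V p) : PreForm E M W p :=
  fun x => (LinearMap.toContinuousLinearMap L).compContinuousAlternatingMap (θ x)

theorem inChart_add (θ η : PreForm E M V p) (e : OpenPartialHomeomorph M E) :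
    (θ + η).inChart e = θ.inChart e + η.inChart e := rfl

theorem inChart_smul (c : ℝ) (θ : PreForm E M V p) (e : OpenPartialHomeomorph M E) :
    (c • θ).inChart e = c • θ.inChart e := rfl

theorem inChart_zero (e : OpenPartialHomeomorph M E) :
    (0 : PreForm E M V p).inChart e = 0 := rfl

theorem IsSmooth.add {θ η : PreForm E M V p} (hθ : θ.IsSmooth) (hη : η.IsSmooth) :
    (θ + η).IsSmooth := fun e he => by
  rw [inChart_add]; exact (hθ e he).add (hη e he)

theorem IsSmooth.smul (c : ℝ) {θ : PreForm E M V p} (hθ : θ.IsSmooth) : (c • θ).IsSmooth :=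
  fun e he => by rw [inChart_smul]; exact (hθ e he).const_smul c

theorem IsSmooth.zero : (0 : PreForm E M V p).IsSmooth := fun e _ => by
  rw [inChart_zero]; exact contDiffOn_const

theorem pullback_add (f : M → N) (θ η : PreForm E' N V p) :
    pullback (E := E) f (θ + η) = pullback f θ + pullback f η := rfl

theorem pullback_smul (f : M → N) (c : ℝ) (θ : PreForm E' N V p) :
    pullback (E := E) f (c • θ) = c • pullback f θ := rfl

theorem pullback_zero (f : M → N) :
    pullback (E := E) f (0 : PreForm E' N V p) = 0 := rfl

theorem mapValues_add [FiniteDimensional ℝ V] (L : V →ₗ[ℝ] W) (θ η : PreForm E M V p) :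
    mapValues L (θ + η) = mapValues L θ + mapValues L η := by
  funext x; ext v; simp [mapValues]

theorem mapValues_smul [FiniteDimensional ℝ V] (L : V →ₗ[ℝ] W) (c : ℝ) (θ : PreForm E M V p) :
    mapValues L (c • θ) = c • mapValues L θ := by
  funext x; ext v; simp [mapValues]

theorem mapValues_zero [FiniteDimensional ℝ V] (L : V →ₗ[ℝ] W) :
    mapValues L (0 : PreForm E M V p) = 0 := by
  funext x; ext v; simp [mapValues]

end PreForm

/-! ### Fibre products of manifolds -/

/-- The fibre product of two maps. -/
@[ext]
structure FiberProduct {M N B : Type*} (f : M → B) (g : N → B) where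
  fst : M
  snd : N
  w : f fst = g snd

namespace FiberProduct

variable {EM EN EB F : Type*} [NormedAddCommGroup EM] [NormedSpace ℝ EM]
  [NormedAddCommGroup EN] [NormedSpace ℝ EN] [NormedAddCommGroup EB] [NormedSpace ℝ EB]
  [NormedAddCommGroup F] [NormedSpace ℝ F]
  {M N B : Type*} [TopologicalSpace M] [ChartedSpace EM M]
  [TopologicalSpace N] [ChartedSpace EN N] [TopologicalSpace B] [ChartedSpace EB B]
  {f : M → B} {g : N → B}

/-- The topology of a subspace of the product. -/
instance : TopologicalSpace (FiberProduct f g) :=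
  TopologicalSpace.induced (fun q => (q.fst, q.snd)) inferInstance

theorem isInducing_pair : Topology.IsInducing fun q : FiberProduct f g => (q.fst, q.snd) := ⟨rfl⟩

theorem continuous_fst : Continuous (fst : FiberProduct f g → M) :=
  _root_.continuous_fst.comp isInducing_pair.continuous

theorem continuous_snd : Continuous (snd : FiberProduct f g → N) :=
  _root_.continuous_snd.comp isInducing_pair.continuous

open Manifold

/-- The first component of the inverse of the chart below. -/
def chartInv (hf : IsSubmersionOfComplement F 𝓘(ℝ, EM) 𝓘(ℝ, EB) ∞ f) (q : FiberProduct f g)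
    (z : F × EN) : M :=
  (hf.isSubmersionAt q.fst).domChart.symm ((hf.isSubmersionAt q.fst).equiv.symm
    ((hf.isSubmersionAt q.fst).codChart (g ((chartAt EN q.snd).symm z.2)), z.1))

/-- The domain of definition of `chartInv`. -/
def chartTarget (hf : IsSubmersionOfComplement F 𝓘(ℝ, EM) 𝓘(ℝ, EB) ∞ f) (q : FiberProduct f g) :
    Set (F × EN) :=
  {z | z.2 ∈ (chartAt EN q.snd).target ∧
    g ((chartAt EN q.snd).symm z.2) ∈ (hf.isSubmersionAt q.fst).codChart.source ∧
    (hf.isSubmersionAt q.fst).equiv.symm ((hf.isSubmersionAt q.fst).codChart (g ((chartAt EN q.snd).symm z.2)), z.1) ∈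
      (hf.isSubmersionAt q.fst).domChart.target}

theorem submersion_eq (hf : IsSubmersionOfComplement F 𝓘(ℝ, EM) 𝓘(ℝ, EB) ∞ f) (x : M)
    {u : EM} (hu : u ∈ (hf.isSubmersionAt x).domChart.target) :
    (hf.isSubmersionAt x).codChart (f ((hf.isSubmersionAt x).domChart.symm u)) = ((hf.isSubmersionAt x).equiv u).1 := by
  have h := (hf.isSubmersionAt x).writtenInCharts
  have hu' : u ∈ ((hf.isSubmersionAt x).domChart.extend 𝓘(ℝ, EM)).target := by simpa using hu
  simpa using h hu'

theorem chartInv_w (hf : IsSubmersionOfComplement F 𝓘(ℝ, EM) 𝓘(ℝ, EB) ∞ f)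
    (q : FiberProduct f g) {z : F × EN} (hz : z ∈ chartTarget hf q) :
    f (chartInv hf q z) = g ((chartAt EN q.snd).symm z.2) := by
  obtain ⟨h1, h2, h3⟩ := hz
  refine (hf.isSubmersionAt q.fst).codChart.injOn ?_ h2 ?_
  · exact (hf.isSubmersionAt q.fst).source_subset_preimage_source ((hf.isSubmersionAt q.fst).domChart.map_target h3)
  · rw [chartInv, submersion_eq hf _ h3]; simp

open Classical in
/-- The inverse of the chart below, with a junk value outside of `chartTarget hf q`. -/
def chartSymm (hf : IsSubmersionOfComplement F 𝓘(ℝ, EM) 𝓘(ℝ, EB) ∞ f) (q : FiberProduct f g)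
    (z : F × EN) : FiberProduct f g :=
  if h : f (chartInv hf q z) = g ((chartAt EN q.snd).symm z.2)
  then ⟨chartInv hf q z, (chartAt EN q.snd).symm z.2, h⟩ else q

theorem chartSymm_eq (hf : IsSubmersionOfComplement F 𝓘(ℝ, EM) 𝓘(ℝ, EB) ∞ f)
    (q : FiberProduct f g) {z : F × EN}
    (h : f (chartInv hf q z) = g ((chartAt EN q.snd).symm z.2)) :
    chartSymm hf q z = ⟨chartInv hf q z, (chartAt EN q.snd).symm z.2, h⟩ := by
  rw [chartSymm, dif_pos h]

theorem chartSymm_fst (hf : IsSubmersionOfComplement F 𝓘(ℝ, EM) 𝓘(ℝ, EB) ∞ f)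
    (q : FiberProduct f g) {z : F × EN} (hz : z ∈ chartTarget hf q) :
    (chartSymm hf q z).fst = chartInv hf q z := by
  rw [chartSymm_eq hf q (chartInv_w hf q hz)]

theorem chartSymm_snd (hf : IsSubmersionOfComplement F 𝓘(ℝ, EM) 𝓘(ℝ, EB) ∞ f)
    (q : FiberProduct f g) {z : F × EN} (hz : z ∈ chartTarget hf q) :
    (chartSymm hf q z).snd = (chartAt EN q.snd).symm z.2 := by
  rw [chartSymm_eq hf q (chartInv_w hf q hz)]

/-- The chart of the fibre product of a submersion `f` and a smooth map `g` around `q`: in suitable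
charts `f` is a projection `EB × F → EB`, and `(x, y)` is sent to the `F`-component of `x`
and the coordinates of `y`. -/
def chart (hf : IsSubmersionOfComplement F 𝓘(ℝ, EM) 𝓘(ℝ, EB) ∞ f) (hg : Continuous g)
    (q : FiberProduct f g) : OpenPartialHomeomorph (FiberProduct f g) (F × EN) where
  toFun r := (((hf.isSubmersionAt q.fst).equiv ((hf.isSubmersionAt q.fst).domChart r.fst)).2, chartAt EN q.snd r.snd)
  invFun := chartSymm hf q
  source := {r | r.fst ∈ (hf.isSubmersionAt q.fst).domChart.source ∧ r.snd ∈ (chartAt EN q.snd).source}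
  target := chartTarget hf q
  map_source' r hr := by
    obtain ⟨h1, h2⟩ := hr
    have h3 : g r.snd ∈ (hf.isSubmersionAt q.fst).codChart.source := by
      rw [← r.w]; exact (hf.isSubmersionAt q.fst).source_subset_preimage_source h1
    have h4 := submersion_eq hf q.fst ((hf.isSubmersionAt q.fst).domChart.map_source h1)
    rw [(hf.isSubmersionAt q.fst).domChart.left_inv h1, r.w] at h4
    refine ⟨(chartAt EN q.snd).map_source h2, ?_, ?_⟩
    · simpa [(chartAt EN q.snd).left_inv h2] using h3
    · simp [(chartAt EN q.snd).left_inv h2, h4, (hf.isSubmersionAt q.fst).domChart.map_source h1]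
  map_target' z hz := by
    refine ⟨?_, ?_⟩
    · rw [chartSymm_fst hf q hz]; exact (hf.isSubmersionAt q.fst).domChart.map_target hz.2.2
    · rw [chartSymm_snd hf q hz]; exact (chartAt EN q.snd).map_target hz.1
  left_inv' r hr := by
    obtain ⟨h1, h2⟩ := hr
    have h4 := submersion_eq hf q.fst ((hf.isSubmersionAt q.fst).domChart.map_source h1)
    rw [(hf.isSubmersionAt q.fst).domChart.left_inv h1, r.w] at h4
    have h5 : chartInv hf q (((hf.isSubmersionAt q.fst).equiv ((hf.isSubmersionAt q.fst).domChart r.fst)).2,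
        chartAt EN q.snd r.snd) = r.fst := by
      simp [chartInv, (chartAt EN q.snd).left_inv h2, h4, (hf.isSubmersionAt q.fst).domChart.left_inv h1]
    have h6 := (chartAt EN q.snd).left_inv h2
    exact (chartSymm_eq hf q (by rw [h5, h6, r.w])).trans (FiberProduct.ext h5 h6)
  right_inv' z hz := by
    rw [chartSymm_fst hf q hz, chartSymm_snd hf q hz, chartInv,
      (hf.isSubmersionAt q.fst).domChart.right_inv hz.2.2, (chartAt EN q.snd).right_inv hz.1]
    simp
  open_source := ((hf.isSubmersionAt q.fst).domChart.open_source.preimage continuous_fst).inter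
    ((chartAt EN q.snd).open_source.preimage continuous_snd)
  open_target := by
    have o1 : IsOpen {z : F × EN | z.2 ∈ (chartAt EN q.snd).target} :=
      (chartAt EN q.snd).open_target.preimage _root_.continuous_snd
    have c1 : ContinuousOn (fun z : F × EN => g ((chartAt EN q.snd).symm z.2))
        {z : F × EN | z.2 ∈ (chartAt EN q.snd).target} :=
      hg.comp_continuousOn ((chartAt EN q.snd).continuousOn_symm.comp
        _root_.continuous_snd.continuousOn fun _ h => h)
    have o2 := c1.isOpen_inter_preimage o1 (hf.isSubmersionAt q.fst).codChart.open_source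
    have c2 : ContinuousOn (fun z : F × EN => (hf.isSubmersionAt q.fst).equiv.symm
        ((hf.isSubmersionAt q.fst).codChart (g ((chartAt EN q.snd).symm z.2)), z.1))
        ({z : F × EN | z.2 ∈ (chartAt EN q.snd).target} ∩
          (fun z : F × EN => g ((chartAt EN q.snd).symm z.2)) ⁻¹' (hf.isSubmersionAt q.fst).codChart.source) :=
      (hf.isSubmersionAt q.fst).equiv.symm.continuous.comp_continuousOn
        (((hf.isSubmersionAt q.fst).codChart.continuousOn.comp (c1.mono Set.inter_subset_left)
          fun _ h => h.2).prodMk _root_.continuous_fst.continuousOn)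
    have o3 := c2.isOpen_inter_preimage o2 (hf.isSubmersionAt q.fst).domChart.open_target
    rw [Set.inter_assoc] at o3
    exact o3
  continuousOn_toFun :=
    (_root_.continuous_snd.comp_continuousOn ((hf.isSubmersionAt q.fst).equiv.continuous.comp_continuousOn
      ((hf.isSubmersionAt q.fst).domChart.continuousOn.comp continuous_fst.continuousOn fun _ h => h.1))).prodMk
      ((chartAt EN q.snd).continuousOn.comp continuous_snd.continuousOn fun _ h => h.2)
  continuousOn_invFun := by
    rw [isInducing_pair.continuousOn_iff]
    have c1 : ContinuousOn (fun z : F × EN => (chartAt EN q.snd).symm z.2) (chartTarget hf q) :=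
      (chartAt EN q.snd).continuousOn_symm.comp _root_.continuous_snd.continuousOn fun _ h => h.1
    have c2 : ContinuousOn (chartInv hf q) (chartTarget hf q) :=
      (hf.isSubmersionAt q.fst).domChart.continuousOn_symm.comp
        ((hf.isSubmersionAt q.fst).equiv.symm.continuous.comp_continuousOn
          (((hf.isSubmersionAt q.fst).codChart.continuousOn.comp (hg.comp_continuousOn c1)
            fun _ h => h.2.1).prodMk _root_.continuous_fst.continuousOn)) fun _ h => h.2.2
    refine (c2.prodMk c1).congr fun z hz => ?_
    simp [chartSymm_fst hf q hz, chartSymm_snd hf q hz]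

theorem mem_chart_source (hf : IsSubmersionOfComplement F 𝓘(ℝ, EM) 𝓘(ℝ, EB) ∞ f)
    (hg : Continuous g) (q : FiberProduct f g) : q ∈ (chart (EN := EN) hf hg q).source :=
  ⟨(hf.isSubmersionAt q.fst).mem_domChart_source, ChartedSpace.mem_chart_source _⟩

theorem chart_symm_fst (hf : IsSubmersionOfComplement F 𝓘(ℝ, EM) 𝓘(ℝ, EB) ∞ f)
    (hg : Continuous g) (q : FiberProduct f g) {z : F × EN} (hz : z ∈ (chart hf hg q).target) :
    ((chart hf hg q).symm z).fst = chartInv hf q z := chartSymm_fst hf q hz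

theorem chart_symm_snd (hf : IsSubmersionOfComplement F 𝓘(ℝ, EM) 𝓘(ℝ, EB) ∞ f)
    (hg : Continuous g) (q : FiberProduct f g) {z : F × EN} (hz : z ∈ (chart hf hg q).target) :
    ((chart hf hg q).symm z).snd = (chartAt EN q.snd).symm z.2 := chartSymm_snd hf q hz

/-- The charted space structure on the fibre product of a submersion and a continuous map. -/
abbrev chartedSpace (hf : IsSubmersionOfComplement F 𝓘(ℝ, EM) 𝓘(ℝ, EB) ∞ f) (hg : Continuous g) :
    ChartedSpace (F × EN) (FiberProduct f g) where
  atlas := Set.range (chart hf hg)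
  chartAt := chart hf hg
  mem_chart_source := mem_chart_source hf hg
  chart_mem_atlas q := ⟨q, rfl⟩

section Smooth

variable [IsManifold 𝓘(ℝ, EN) ∞ N]

theorem contMDiffOn_chart_symm_snd (hf : IsSubmersionOfComplement F 𝓘(ℝ, EM) 𝓘(ℝ, EB) ∞ f)
    (hg : Continuous g) (q : FiberProduct f g) :
    ContMDiffOn 𝓘(ℝ, F × EN) 𝓘(ℝ, EN) ∞ (fun z : F × EN => ((chart hf hg q).symm z).snd)
      (chart (EN := EN) hf hg q).target := by
  refine ContMDiffOn.congr (f := fun z : F × EN => (chartAt EN q.snd).symm z.2) ?_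
    fun z hz => chart_symm_snd hf hg q hz
  exact contMDiffOn_chart_symm.comp contDiff_snd.contMDiff.contMDiffOn fun _ h => h.1

variable [IsManifold 𝓘(ℝ, EM) ∞ M] [IsManifold 𝓘(ℝ, EB) ∞ B]

theorem contMDiffOn_chart_symm_fst (hf : IsSubmersionOfComplement F 𝓘(ℝ, EM) 𝓘(ℝ, EB) ∞ f)
    (hg : ContMDiff 𝓘(ℝ, EN) 𝓘(ℝ, EB) ∞ g) (q : FiberProduct f g) :
    ContMDiffOn 𝓘(ℝ, F × EN) 𝓘(ℝ, EM) ∞ (fun z : F × EN => ((chart hf hg.continuous q).symm z).fst)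
      (chart (EN := EN) hf hg.continuous q).target := by
  refine ContMDiffOn.congr (f := chartInv hf q) ?_
    fun z hz => chart_symm_fst hf hg.continuous q hz
  have c1 : ContMDiffOn 𝓘(ℝ, F × EN) 𝓘(ℝ, EN) ∞ (fun z : F × EN => (chartAt EN q.snd).symm z.2)
      (chartTarget hf q) :=
    contMDiffOn_chart_symm.comp contDiff_snd.contMDiff.contMDiffOn fun _ h => h.1
  have c2 : ContMDiffOn 𝓘(ℝ, F × EN) 𝓘(ℝ, EB) ∞
      (fun z : F × EN => (hf.isSubmersionAt q.fst).codChart (g ((chartAt EN q.snd).symm z.2)))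
      (chartTarget hf q) :=
    (contMDiffOn_of_mem_maximalAtlas (hf.isSubmersionAt q.fst).codChart_mem_maximalAtlas).comp
      (hg.comp_contMDiffOn c1) fun _ h => h.2.1
  have c3 : ContMDiffOn 𝓘(ℝ, F × EN) 𝓘(ℝ, EM) ∞
      (fun z : F × EN => (hf.isSubmersionAt q.fst).equiv.symm
        ((hf.isSubmersionAt q.fst).codChart (g ((chartAt EN q.snd).symm z.2)), z.1)) (chartTarget hf q) :=
    (hf.isSubmersionAt q.fst).equiv.symm.contDiff.contMDiff.comp_contMDiffOn
      (c2.prodMk_space contDiff_fst.contMDiff.contMDiffOn)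
  exact (contMDiffOn_symm_of_mem_maximalAtlas (hf.isSubmersionAt q.fst).domChart_mem_maximalAtlas).comp c3
    fun _ h => h.2.2

/-- The fibre product of a submersion and a smooth map is a smooth manifold. -/
theorem isManifold (hf : IsSubmersionOfComplement F 𝓘(ℝ, EM) 𝓘(ℝ, EB) ∞ f)
    (hg : ContMDiff 𝓘(ℝ, EN) 𝓘(ℝ, EB) ∞ g) :
    letI := chartedSpace (EN := EN) hf hg.continuous
    IsManifold 𝓘(ℝ, F × EN) ∞ (FiberProduct f g) := by
  let _ := chartedSpace (EN := EN) hf hg.continuous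
  refine isManifold_of_contDiffOn _ _ _ ?_
  rintro _ _ ⟨q, rfl⟩ ⟨r, rfl⟩
  simp only [modelWithCornersSelf_coe, modelWithCornersSelf_coe_symm, Function.id_comp,
    Function.comp_id, Set.preimage_id, Set.range_id, Set.inter_univ,
    OpenPartialHomeomorph.coe_trans, OpenPartialHomeomorph.trans_source,
    OpenPartialHomeomorph.symm_source]
  rw [← contMDiffOn_iff_contDiffOn]
  have c1 := (contMDiffOn_chart_symm_fst (EN := EN) hf hg q).mono
    (Set.inter_subset_left (t := (chart (EN := EN) hf hg.continuous q).symm ⁻¹'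
      (chart (EN := EN) hf hg.continuous r).source))
  have c2 := (contMDiffOn_chart_symm_snd (EN := EN) hf hg.continuous q).mono
    (Set.inter_subset_left (t := (chart (EN := EN) hf hg.continuous q).symm ⁻¹'
      (chart (EN := EN) hf hg.continuous r).source))
  have c3 := (contMDiffOn_of_mem_maximalAtlas (hf.isSubmersionAt r.fst).domChart_mem_maximalAtlas).comp c1
    fun _ h => h.2.1
  have c4 := (contMDiffOn_chart (I := 𝓘(ℝ, EN)) (n := ∞) (x := r.snd) (H := EN)).comp c2 fun _ h => h.2.2
  exact (contDiff_snd.contMDiff.comp_contMDiffOn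
    ((hf.isSubmersionAt r.fst).equiv.contDiff.contMDiff.comp_contMDiffOn c3)).prodMk_space c4

end Smooth

end FiberProduct

/-! ### Lie 2-algebras -/

/-- A Lie ring with a norm on the underlying abelian group (no compatibility with the bracket). -/
class NormedLieRing (L : Type*) extends NormedAddCommGroup L, LieRing L

/-- A real Lie algebra with a norm on the underlying vector space. The norm only serves to speak
of smooth functions; on a finite-dimensional Lie algebra its choice does not matter. -/
class NormedLieAlgebra (L : Type*) [NormedLieRing L] extends NormedSpace ℝ L, LieAlgebra ℝ L

/-- The Lie bracket as a bilinear map. -/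
def lieBracket (L : Type*) [LieRing L] [LieAlgebra ℝ L] : L →ₗ[ℝ] L →ₗ[ℝ] L :=
  LinearMap.mk₂ ℝ (fun X Y => ⁅X, Y⁆) add_lie smul_lie lie_add (fun c X Y => lie_smul c X Y)

/-- A strict Lie 2-algebra `(𝔥, 𝔤, t_*, α_*)`: a homomorphism `t_* : 𝔥 → 𝔤` of Lie algebras and
an action `α_*` of `𝔤` on `𝔥` by derivations. -/
structure Lie2Algebra (𝔥 𝔤 : Type*) [LieRing 𝔥] [LieAlgebra ℝ 𝔥] [LieRing 𝔤] [LieAlgebra ℝ 𝔤] where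
  t : 𝔥 →ₗ⁅ℝ⁆ 𝔤
  α : 𝔤 →ₗ⁅ℝ⁆ LieDerivation ℝ 𝔥 𝔥
  α_t : ∀ Y₁ Y₂ : 𝔥, α (t Y₁) Y₂ = ⁅Y₁, Y₂⁆
  t_α : ∀ (X : 𝔤) (Y : 𝔥), t (α X Y) = ⁅X, t Y⁆

/-- The action `α_*` as a bilinear map. -/
def Lie2Algebra.action {𝔥 𝔤 : Type*} [LieRing 𝔥] [LieAlgebra ℝ 𝔥] [LieRing 𝔤] [LieAlgebra ℝ 𝔤]
    (γ : Lie2Algebra 𝔥 𝔤) : 𝔤 →ₗ[ℝ] 𝔥 →ₗ[ℝ] 𝔥 :=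
  LinearMap.mk₂ ℝ (fun X Y => γ.α X Y) (by simp) (by simp) (by simp) (by simp)

/-! ### Lie groupoids -/

open Manifold

section LieGroupoid

variable (E₀ P₀ E₁ P₁ : Type*) [NormedAddCommGroup E₀] [NormedSpace ℝ E₀]
  [TopologicalSpace P₀] [ChartedSpace E₀ P₀] [NormedAddCommGroup E₁] [NormedSpace ℝ E₁]
  [TopologicalSpace P₁] [ChartedSpace E₁ P₁]

/-- A manifold `P₀` of objects, a manifold `P₁` of morphisms, and two submersions, source and
target. -/
structure SmoothGraph where
  s : P₁ → P₀
  t : P₁ → P₀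
  submersion_s : IsSubmersion 𝓘(ℝ, E₁) 𝓘(ℝ, E₀) ∞ s
  submersion_t : IsSubmersion 𝓘(ℝ, E₁) 𝓘(ℝ, E₀) ∞ t

variable {E₀ P₀ E₁ P₁}

/-- The space `P₂` of composable pairs `(ρ₁, ρ₂)`, with `s ρ₁ = t ρ₂`. -/
abbrev SmoothGraph.Pairs (G : SmoothGraph E₀ P₀ E₁ P₁) : Type _ := FiberProduct G.s G.t

/-- The model space of the manifold `P₂`. -/
abbrev SmoothGraph.PairsModel (G : SmoothGraph E₀ P₀ E₁ P₁) : Type _ :=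
  G.submersion_s.complement × E₁

instance (G : SmoothGraph E₀ P₀ E₁ P₁) : ChartedSpace G.PairsModel G.Pairs :=
  FiberProduct.chartedSpace G.submersion_s.isSubmersionOfComplement_complement
    G.submersion_t.contMDiff.continuous

instance [IsManifold 𝓘(ℝ, E₀) ∞ P₀] [IsManifold 𝓘(ℝ, E₁) ∞ P₁] (G : SmoothGraph E₀ P₀ E₁ P₁) :
    IsManifold 𝓘(ℝ, G.PairsModel) ∞ G.Pairs :=
  FiberProduct.isManifold G.submersion_s.isSubmersionOfComplement_complement
    G.submersion_t.contMDiff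

variable (E₀ P₀ E₁ P₁) in
/-- A Lie groupoid. The composition `comp ⟨ρ₁, ρ₂, _⟩` is `ρ₁ ∘ ρ₂`. -/
structure LieGroupoid where
  graph : SmoothGraph E₀ P₀ E₁ P₁
  one : P₀ → P₁
  inv : P₁ → P₁
  comp : graph.Pairs → P₁
  smooth_one : ContMDiff 𝓘(ℝ, E₀) 𝓘(ℝ, E₁) ∞ one
  smooth_inv : ContMDiff 𝓘(ℝ, E₁) 𝓘(ℝ, E₁) ∞ inv
  smooth_comp : ContMDiff 𝓘(ℝ, graph.PairsModel) 𝓘(ℝ, E₁) ∞ comp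
  s_one : ∀ x, graph.s (one x) = x
  t_one : ∀ x, graph.t (one x) = x
  s_inv : ∀ g, graph.s (inv g) = graph.t g
  t_inv : ∀ g, graph.t (inv g) = graph.s g
  s_comp : ∀ q, graph.s (comp q) = graph.s q.snd
  t_comp : ∀ q, graph.t (comp q) = graph.t q.fst
  one_comp : ∀ g, comp ⟨one (graph.t g), g, s_one _⟩ = g
  comp_one : ∀ g, comp ⟨g, one (graph.s g), (t_one _).symm⟩ = g
  inv_comp : ∀ g, comp ⟨inv g, g, s_inv g⟩ = one (graph.s g)
  comp_inv : ∀ g, comp ⟨g, inv g, (t_inv g).symm⟩ = one (graph.t g)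
  assoc : ∀ (g h k : P₁) (hgh : graph.s g = graph.t h) (hhk : graph.s h = graph.t k),
    comp ⟨comp ⟨g, h, hgh⟩, k, (s_comp ⟨g, h, hgh⟩).trans hhk⟩ =
      comp ⟨g, comp ⟨h, k, hhk⟩, hgh.trans (t_comp ⟨h, k, hhk⟩).symm⟩

/-- The source map. -/
abbrev LieGroupoid.s (G : LieGroupoid E₀ P₀ E₁ P₁) : P₁ → P₀ := G.graph.s

/-- The target map. -/
abbrev LieGroupoid.t (G : LieGroupoid E₀ P₀ E₁ P₁) : P₁ → P₀ := G.graph.t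

variable {V : Type*} [NormedAddCommGroup V] [NormedSpace ℝ V] {p : ℕ}

/-- `Δ = t^* - s^*`, from forms on `P₀` to forms on `P₁`. -/
def LieGroupoid.delta₀ (G : LieGroupoid E₀ P₀ E₁ P₁) (θ : PreForm E₀ P₀ V p) :
    PreForm E₁ P₁ V p :=
  θ.pullback G.t - θ.pullback G.s

/-- `Δ = pr₁^* - c^* + pr₂^*`, from forms on `P₁` to forms on the manifold `P₂` of composable
pairs, where `c` is the composition. -/
def LieGroupoid.delta₁ (G : LieGroupoid E₀ P₀ E₁ P₁) (θ : PreForm E₁ P₁ V p) :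
    PreForm G.graph.PairsModel G.graph.Pairs V p :=
  θ.pullback FiberProduct.fst - θ.pullback G.comp + θ.pullback FiberProduct.snd

end LieGroupoid

/-! ### Forms on a Lie groupoid with values in a Lie 2-algebra -/

/-- Transport along an equality of degrees. -/
def castDeg (A : ℕ → Type*) {p q : ℕ} (h : p = q) (x : A p) : A q := h ▸ x

section GroupoidForms

variable {E₀ P₀ E₁ P₁ 𝔥 𝔤 : Type*} [NormedAddCommGroup E₀] [NormedSpace ℝ E₀]
  [TopologicalSpace P₀] [ChartedSpace E₀ P₀] [NormedAddCommGroup E₁] [NormedSpace ℝ E₁]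
  [TopologicalSpace P₁] [ChartedSpace E₁ P₁]
  [NormedLieRing 𝔥] [NormedLieAlgebra 𝔥] [FiniteDimensional ℝ 𝔥]
  [NormedLieRing 𝔤] [NormedLieAlgebra 𝔤] [FiniteDimensional ℝ 𝔤]

/-- Triples `(Ψᵃ, Ψᵇ, Ψᶜ)` of a `p`-form on `P₀` with values in `𝔤`, a `p`-form on `P₁` with values
in `𝔥` and a `(p+1)`-form on `P₀` with values in `𝔥`, without smoothness and other conditions. -/
abbrev PreOmega (_ : LieGroupoid E₀ P₀ E₁ P₁) (_ : Lie2Algebra 𝔥 𝔤) (p : ℕ) : Type _ :=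
  PreForm E₀ P₀ 𝔤 p × PreForm E₁ P₁ 𝔥 p × PreForm E₀ P₀ 𝔥 (p + 1)

variable (G : LieGroupoid E₀ P₀ E₁ P₁) (γ : Lie2Algebra 𝔥 𝔤)

/-- The space `Ω^p(P, γ)` of `p`-forms on the Lie groupoid with values in `γ`: triples of smooth
forms with `Δ Ψᵃ = t_* Ψᵇ` and `Δ Ψᵇ = 0`. -/
def Omega (p : ℕ) : Submodule ℝ (PreOmega G γ p) where
  carrier := {Ψ | Ψ.1.IsSmooth ∧ Ψ.2.1.IsSmooth ∧ Ψ.2.2.IsSmooth ∧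
    G.delta₀ Ψ.1 = Ψ.2.1.mapValues (γ.t : 𝔥 →ₗ[ℝ] 𝔤) ∧ G.delta₁ Ψ.2.1 = 0}
  add_mem' := by
    rintro Ψ Φ ⟨h1, h2, h3, h4, h5⟩ ⟨k1, k2, k3, k4, k5⟩
    refine ⟨h1.add k1, h2.add k2, h3.add k3, ?_, ?_⟩
    · simp only [LieGroupoid.delta₀, Prod.fst_add, Prod.snd_add, PreForm.pullback_add,
        PreForm.mapValues_add] at h4 k4 ⊢
      rw [← h4, ← k4]; abel
    · simp only [LieGroupoid.delta₁, Prod.fst_add, Prod.snd_add, PreForm.pullback_add] at h5 k5 ⊢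
      rw [← add_zero (0 : PreForm G.graph.PairsModel G.graph.Pairs 𝔥 p)]
      nth_rw 1 [← h5]; rw [← k5]; abel
  zero_mem' := by
    refine ⟨.zero, .zero, .zero, ?_, ?_⟩
    · simp [LieGroupoid.delta₀, PreForm.pullback_zero, PreForm.mapValues_zero]
    · simp [LieGroupoid.delta₁, PreForm.pullback_zero]
  smul_mem' := by
    rintro c Ψ ⟨h1, h2, h3, h4, h5⟩
    refine ⟨h1.smul c, h2.smul c, h3.smul c, ?_, ?_⟩
    · simp only [LieGroupoid.delta₀, Prod.smul_fst, Prod.smul_snd, PreForm.pullback_smul,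
        PreForm.mapValues_smul] at h4 ⊢
      rw [← h4, smul_sub]
    · simp only [LieGroupoid.delta₁, Prod.smul_fst, Prod.smul_snd, PreForm.pullback_smul] at h5 ⊢
      rw [← smul_sub, ← smul_add, h5, smul_zero]

variable {G γ}

/-- The formula for the differential `D`. -/
def preD {p : ℕ} (Ψ : PreOmega G γ p) : PreOmega G γ (p + 1) :=
  (Ψ.1.extd - (-1 : ℝ) ^ p • Ψ.2.2.mapValues (γ.t : 𝔥 →ₗ[ℝ] 𝔤),
    Ψ.2.1.extd - (-1 : ℝ) ^ p • G.delta₀ Ψ.2.2,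
    Ψ.2.2.extd)

/-- The formula for the bracket `[Ψ ∧ Φ]`. -/
def preBracket {k l : ℕ} (Ψ : PreOmega G γ k) (Φ : PreOmega G γ l) : PreOmega G γ (k + l) :=
  (Ψ.1.wedge (lieBracket 𝔤) Φ.1,
    Ψ.2.1.wedge (lieBracket 𝔥) Φ.2.1 + (Ψ.1.pullback G.s).wedge γ.action Φ.2.1 -
      (-1 : ℝ) ^ (k * l) • castDeg (PreForm E₁ P₁ 𝔥) (Nat.add_comm l k)
        ((Φ.1.pullback G.s).wedge γ.action Ψ.2.1),
    Ψ.1.wedge γ.action Φ.2.2 -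
      (-1 : ℝ) ^ (k * l) • castDeg (PreForm E₀ P₀ 𝔥) (by omega : l + (k + 1) = k + l + 1)
        (Φ.1.wedge γ.action Ψ.2.2))

end GroupoidForms

/-! ### Differential graded Lie algebras -/

/-- A differential `D` and a bracket on a family `A` of real vector spaces, both linear, turn `A`
into a differential graded Lie algebra. -/
structure IsDGLA (A : ℕ → Type*) [∀ p, AddCommGroup (A p)] [∀ p, Module ℝ (A p)]
    (D : ∀ p, A p →ₗ[ℝ] A (p + 1)) (br : ∀ k l, A k →ₗ[ℝ] A l →ₗ[ℝ] A (k + l)) : Prop where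
  D_D : ∀ (p : ℕ) (Ψ : A p), D (p + 1) (D p Ψ) = 0
  antisymm : ∀ (k l : ℕ) (Ψ : A k) (Φ : A l),
    castDeg A (Nat.add_comm l k) (br l k Φ Ψ) = -((-1 : ℝ) ^ (k * l) • br k l Ψ Φ)
  jacobi : ∀ (k l i : ℕ) (Ψ : A k) (Φ : A l) (Ξ : A i),
    (-1 : ℝ) ^ (k * i) • br (k + l) i (br k l Ψ Φ) Ξ +
      (-1 : ℝ) ^ (l * i) • castDeg A (by omega : i + k + l = k + l + i)
        (br (i + k) l (br i k Ξ Ψ) Φ) +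
      (-1 : ℝ) ^ (k * l) • castDeg A (by omega : l + i + k = k + l + i)
        (br (l + i) k (br l i Φ Ξ) Ψ) = 0
  leibniz : ∀ (k l : ℕ) (Ψ : A k) (Φ : A l),
    D (k + l) (br k l Ψ Φ) =
      castDeg A (by omega : k + 1 + l = k + l + 1) (br (k + 1) l (D k Ψ) Φ) +
        (-1 : ℝ) ^ k • br k (l + 1) Ψ (D l Φ)

end GForms

end

/-! The three components of a form are governed by three mechanisms. On a single manifold, forms
with coefficients obey graded commutativity, associativity and the Leibniz rule for any compatible
bilinear maps. The wedge is written as a signed sum over all permutations divided by `p! q!`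
(`wedgeAlg_apply`). The lemma `altSum_altSum` absorbs inner antisymmetrisations, which gives
`wedgeAlg_assoc` and the Leibniz rule `extDeriv_wedge`. Lie algebra identities among the
coefficients then become graded identities of forms: `wedgeTo_antisymm`, `wedgeTo_action`,
`wedgeTo_jacobi`. Chart expressions carry the calculus to manifolds, where `d` is independent of the
chart, commutes with pullbacks and squares to zero.

On the groupoid, the relations `s ∘ c = s ∘ pr₂`, `t ∘ c = t ∘ pr₁` and `s ∘ pr₁ = t ∘ pr₂` give `Δ²
= 0`, and `Δ` commutes with `d`. For elements of `Omega` the defining conditions read `t^*Ψᵃ = s^*Ψᵃ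
+ t_*Ψᵇ` and `c^*Ψᵇ = pr₁^*Ψᵇ + pr₂^*Ψᵇ`. Substituting them and using the two axioms that relate
`t_*` and `α_*` proves closure under the bracket (`preBracket_mem`) and the Leibniz rule
(`preD_preBracket`).

For the Jacobi identity, the pair `(s^*Ψᵃ, Ψᵇ)` is one form with values in the semidirect product of
`𝔤` and `𝔥`, and the b-component of the bracket is the `𝔥`-part of the wedge bracket there
(`pairForm_preBracket`). So the b-component is the graded Jacobi identity of a Lie algebra. The
c-component expresses only that `α_*` is an action. -/

noncomputable section

namespace GForms

/-! ### Signed sums over permutations -/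

section AltSum

variable {ι κ κ' T U W : Type*} [Fintype ι] [DecidableEq ι] [Fintype κ] [DecidableEq κ]
  [Fintype κ'] [DecidableEq κ'] [AddCommGroup U] [Module ℝ U] [AddCommGroup W] [Module ℝ W]

/-- The signed sum over all permutations of the arguments of a function. -/
def altSum (f : (ι → T) → U) (v : ι → T) : U :=
  ∑ σ : Equiv.Perm ι, ((Equiv.Perm.sign σ : ℤ) : ℝ) • f (v ∘ σ)

theorem sign_mul_self_real (σ : Equiv.Perm ι) :
    ((Equiv.Perm.sign σ : ℤ) : ℝ) * ((Equiv.Perm.sign σ : ℤ) : ℝ) = 1 := by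
  rcases Int.units_eq_one_or (Equiv.Perm.sign σ) with h | h <;> simp [h]

theorem altSum_comp_perm (f : (ι → T) → U) (τ : Equiv.Perm ι) (v : ι → T) :
    altSum (fun w => f (w ∘ τ)) v = ((Equiv.Perm.sign τ : ℤ) : ℝ) • altSum f v := by
  unfold altSum
  rw [Finset.smul_sum]
  refine Fintype.sum_equiv (Equiv.mulRight τ) _ _ fun σ => ?_
  have h := sign_mul_self_real τ
  simp only [Equiv.coe_mulRight, Equiv.Perm.sign_mul, Units.val_mul, Int.cast_mul, smul_smul,
    Equiv.Perm.coe_mul, Function.comp_assoc]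
  rw [mul_left_comm, h, mul_one]

theorem altSum_comp_equiv (f : (κ → T) → U) (e : κ ≃ ι) (v : ι → T) :
    altSum (fun w : ι → T => f (w ∘ e)) v = altSum f (v ∘ e) := by
  unfold altSum
  refine (Fintype.sum_equiv e.permCongr _ _ fun σ => ?_).symm
  rw [Equiv.Perm.sign_permCongr]
  congr 2
  funext i
  simp

theorem altSum_smul (c : ℝ) (f : (ι → T) → U) (v : ι → T) :
    altSum (fun w => c • f w) v = c • altSum f v := by
  simp only [altSum, Finset.smul_sum, smul_comm c]

theorem altSum_sum {α : Type*} (s : Finset α) (f : α → (ι → T) → U) (v : ι → T) :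
    altSum (fun w => ∑ a ∈ s, f a w) v = ∑ a ∈ s, altSum (f a) v := by
  simp only [altSum, Finset.smul_sum]
  exact Finset.sum_comm

theorem altSum_add (f g : (ι → T) → U) (v : ι → T) :
    altSum (fun w => f w + g w) v = altSum f v + altSum g v := by
  simp only [altSum, smul_add, Finset.sum_add_distrib]

theorem map_altSum (L : U →ₗ[ℝ] W) (f : (ι → T) → U) (v : ι → T) :
    L (altSum f v) = altSum (fun w => L (f w)) v := by
  simp [altSum]

/-- A signed sum over the permutations of a block of arguments is absorbed by the signed sum over
all permutations. -/
theorem altSum_altSum (G : (κ' → T) → (κ → T) → U) (e : κ ⊕ κ' ≃ ι) (v : ι → T) :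
    altSum (fun w : ι → T => altSum (G (w ∘ e ∘ Sum.inr)) (w ∘ e ∘ Sum.inl)) v =
      ((Fintype.card κ).factorial : ℝ) •
        altSum (fun w : ι → T => G (w ∘ e ∘ Sum.inr) (w ∘ e ∘ Sum.inl)) v := by
  -- Extend `τ` by the identity on the other block. Reindexing the outer sum by this permutation
  -- produces the sign of `τ` a second time, so all `(card κ)!` inner terms contribute equally.
  have key : ∀ τ : Equiv.Perm κ, altSum (fun w : ι → T => ((Equiv.Perm.sign τ : ℤ) : ℝ) •
      G (w ∘ e ∘ Sum.inr) ((w ∘ e ∘ Sum.inl) ∘ τ)) v =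
      altSum (fun w : ι → T => G (w ∘ e ∘ Sum.inr) (w ∘ e ∘ Sum.inl)) v := by
    intro τ
    have h := altSum_comp_perm (fun w : ι → T => G (w ∘ e ∘ Sum.inr) (w ∘ e ∘ Sum.inl))
      (e.permCongr (Equiv.Perm.sumCongr τ 1)) v
    rw [Equiv.Perm.sign_permCongr, Equiv.Perm.sign_sumCongr, Equiv.Perm.sign_one, mul_one] at h
    rw [altSum_smul, ← one_smul ℝ (altSum (fun w : ι → T => G (w ∘ e ∘ Sum.inr)
      (w ∘ e ∘ Sum.inl)) v), ← sign_mul_self_real τ, mul_smul, ← h]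
    congr 2
    funext w
    have h1 : (w ∘ e.permCongr (Equiv.Perm.sumCongr τ 1)) ∘ e ∘ Sum.inr = w ∘ e ∘ Sum.inr := by
      funext i; simp
    have h2 : (w ∘ e.permCongr (Equiv.Perm.sumCongr τ 1)) ∘ e ∘ Sum.inl =
      (w ∘ e ∘ Sum.inl) ∘ τ := by funext i; simp
    rw [h1, h2]
  conv_lhs =>
    arg 1
    ext w
    rw [altSum]
  rw [altSum_sum, Finset.sum_congr rfl fun τ _ => key τ, Finset.sum_const, Finset.card_univ,
    Fintype.card_perm, Nat.cast_smul_eq_nsmul]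

/-- The cycle that brings position `i` to the front has sign `(-1)^i`, so the `n + 1` summands have
the same signed sum. This matches the formula for the exterior derivative, where the direction of
differentiation is the omitted argument. -/
theorem altSum_sum_removeNth {n : ℕ} (f : T → (Fin n → T) → U) (v : Fin (n + 1) → T) :
    altSum (fun w : Fin (n + 1) → T =>
        ∑ i : Fin (n + 1), (-1 : ℝ) ^ (i : ℕ) • f (w i) (i.removeNth w)) v =
      ((n + 1 : ℕ) : ℝ) • altSum (fun w : Fin (n + 1) → T => f (w 0) (w ∘ Fin.succ)) v := by
  have key : ∀ i : Fin (n + 1),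
      altSum (fun w : Fin (n + 1) → T => (-1 : ℝ) ^ (i : ℕ) • f (w i) (i.removeNth w)) v =
      altSum (fun w : Fin (n + 1) → T => f (w 0) (w ∘ Fin.succ)) v := fun i => by
    have h := altSum_comp_perm (fun w : Fin (n + 1) → T => f (w 0) (w ∘ Fin.succ))
      i.cycleRange.symm v
    rw [Equiv.Perm.sign_symm, Fin.sign_cycleRange] at h
    push_cast at h
    have h2 : (fun w : Fin (n + 1) → T => f ((w ∘ i.cycleRange.symm) 0)
        ((w ∘ i.cycleRange.symm) ∘ Fin.succ)) = fun w => f (w i) (i.removeNth w) := by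
      funext w
      have : (w ∘ i.cycleRange.symm) ∘ Fin.succ = i.removeNth w := by
        funext j; simp [Fin.removeNth]
      rw [this]; simp
    rw [h2] at h
    rw [altSum_smul, h, smul_smul, ← mul_pow]
    simp
  rw [altSum_sum, Finset.sum_congr rfl fun i _ => key i, Finset.sum_const, Finset.card_univ,
    Fintype.card_fin, Nat.cast_smul_eq_nsmul]

end AltSum

/-! ### The wedge product as a normalised signed sum; commutativity and associativity. -/

section WedgeFormula

variable {T V W U : Type*} [AddCommGroup T] [Module ℝ T] [AddCommGroup V] [Module ℝ V]
    [AddCommGroup W] [Module ℝ W] [AddCommGroup U] [Module ℝ U]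

theorem altSum_alternatingMap {ι : Type*} [Fintype ι] [DecidableEq ι] (θ : T [⋀^ι]→ₗ[ℝ] V)
    (v : ι → T) : altSum θ v = ((Fintype.card ι).factorial : ℝ) • θ v := by
  have h : ∀ σ : Equiv.Perm ι, ((Equiv.Perm.sign σ : ℤ) : ℝ) • θ (v ∘ σ) = θ v := fun σ => by
    rw [θ.map_perm, Units.smul_def, ← Int.cast_smul_eq_zsmul ℝ, smul_smul, sign_mul_self_real,
      one_smul]
  rw [altSum, Finset.sum_congr rfl fun σ _ => h σ, Finset.sum_const, Finset.card_univ,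
    Fintype.card_perm, Nat.cast_smul_eq_nsmul]

theorem wedgeAlg_apply (B : V →ₗ[ℝ] W →ₗ[ℝ] U) {p q : ℕ} (θ : T [⋀^Fin p]→ₗ[ℝ] V)
    (η : T [⋀^Fin q]→ₗ[ℝ] W) (v : Fin (p + q) → T) :
    wedgeAlg B θ η v = ((p.factorial : ℝ) * q.factorial)⁻¹ •
      altSum (fun w : Fin (p + q) → T => B (θ (w ∘ Fin.castAdd q)) (η (w ∘ Fin.natAdd p))) v := by
  -- Antisymmetrising the tensor product of two maps that are already alternating gives `p! q!`
  -- times the shuffle sum.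
  have h1 := congrArg (fun f => TensorProduct.lift B (f (v ∘ finSumFinEquiv)))
    (MultilinearMap.domCoprod_alternization_eq θ η)
  simp only [MultilinearMap.alternatization_apply, Fintype.card_fin, AlternatingMap.smul_apply,
    map_nsmul, map_sum] at h1
  rw [← Nat.cast_smul_eq_nsmul ℝ] at h1
  rw [eq_inv_smul_iff₀ (by positivity)]
  push_cast at h1
  refine h1.symm.trans ?_
  have h2 := altSum_comp_equiv (fun w : Fin p ⊕ Fin q → T => B (θ (w ∘ Sum.inl)) (η (w ∘ Sum.inr)))
    finSumFinEquiv v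
  refine Eq.trans ?_ h2.symm
  refine Finset.sum_congr rfl fun σ _ => ?_
  rw [Units.smul_def, map_zsmul, ← Int.cast_smul_eq_zsmul ℝ]
  rfl

/-- The exchange of two consecutive blocks of `p` and `q` elements. -/
def blockSwap (p q : ℕ) : Equiv.Perm (Fin (p + q)) :=
  finAddFlip.trans (finCongr (Nat.add_comm q p))

theorem finRotate_pow_val (n j : ℕ) (k : Fin n) : ((finRotate n ^ j) k : ℕ) = (k + j) % n := by
  induction j with
  | zero => simp [Nat.mod_eq_of_lt k.2]
  | succ j ih =>
    obtain _ | n := n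
    · exact k.elim0
    · rw [pow_succ', Equiv.Perm.mul_apply, finRotate_apply, Fin.val_add, ih]
      simp [← add_assoc]

theorem blockSwap_eq_pow (p q : ℕ) : blockSwap p q = finRotate (p + q) ^ q := by
  ext k
  rw [finRotate_pow_val]
  refine Fin.addCases (fun i => ?_) (fun i => ?_) k
  · simp only [blockSwap, Equiv.trans_apply, finAddFlip_apply_castAdd, finCongr_apply,
      Fin.val_cast, Fin.val_natAdd, Fin.val_castAdd]
    rw [Nat.mod_eq_of_lt (by omega), add_comm]
  · simp only [blockSwap, Equiv.trans_apply, finAddFlip_apply_natAdd, finCongr_apply,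
      Fin.val_cast, Fin.val_natAdd, Fin.val_castAdd]
    rw [add_right_comm, Nat.add_mod_left, Nat.mod_eq_of_lt (by omega)]

/-- The block exchange is the `q`-th power of a full rotation, whose sign is `(-1)^(p+q-1)`; the
surplus exponent `q(q-1)` is even. -/
theorem sign_blockSwap (p q : ℕ) : Equiv.Perm.sign (blockSwap p q) = (-1) ^ (p * q) := by
  rw [blockSwap_eq_pow, map_pow, sign_finRotate, ← pow_mul]
  -- The case `q = 0` is separate because of the truncated subtraction in `p + q - 1`.
  obtain _ | q := q
  · simp
  · have : (p + (q + 1) - 1) * (q + 1) = p * (q + 1) + q * (q + 1) := by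
      rw [← add_assoc, Nat.add_sub_cancel, add_mul]
    rw [this, pow_add, (Nat.even_mul_succ_self q).neg_one_pow, mul_one]

theorem wedgeAlg_comm (B : V →ₗ[ℝ] W →ₗ[ℝ] U) {p q : ℕ} (θ : T [⋀^Fin q]→ₗ[ℝ] V)
    (η : T [⋀^Fin p]→ₗ[ℝ] W) (v : Fin (p + q) → T) :
    wedgeAlg B θ η (v ∘ Fin.cast (Nat.add_comm q p)) =
      (-1 : ℝ) ^ (p * q) • wedgeAlg B.flip η θ v := by
  rw [wedgeAlg_apply, wedgeAlg_apply, smul_comm, mul_comm (q.factorial : ℝ)]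
  congr 1
  have h1 := altSum_comp_equiv (fun w : Fin (q + p) → T =>
    B (θ (w ∘ Fin.castAdd p)) (η (w ∘ Fin.natAdd q))) (finCongr (Nat.add_comm q p)) v
  refine h1.symm.trans ?_
  have h2 := altSum_comp_perm (fun w : Fin (p + q) → T =>
    B.flip (η (w ∘ Fin.castAdd q)) (θ (w ∘ Fin.natAdd p))) (blockSwap p q) v
  rw [sign_blockSwap] at h2
  push_cast at h2
  rw [← h2]
  congr 1
  funext w
  have h3 : (w ∘ finCongr (Nat.add_comm q p)) ∘ Fin.castAdd p =
      (w ∘ blockSwap p q) ∘ Fin.natAdd p := by funext i; simp [blockSwap]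
  have h4 : (w ∘ finCongr (Nat.add_comm q p)) ∘ Fin.natAdd q =
      (w ∘ blockSwap p q) ∘ Fin.castAdd q := by funext i; simp [blockSwap]
  rw [LinearMap.flip_apply, h3, h4]

/-- Here `g` need not be alternating: the outer signed sum antisymmetrises anyway. The `p!` from
`altSum_altSum` cancels the one in the normalisation of the wedge, leaving `c / q!`. -/
theorem wedgeAlg_altSum_left (A : V →ₗ[ℝ] W →ₗ[ℝ] U) {p q : ℕ} {θ : T [⋀^Fin p]→ₗ[ℝ] V} {c : ℝ}
    {g : (Fin p → T) → V} (hθ : ∀ v, θ v = c • altSum g v) (η : T [⋀^Fin q]→ₗ[ℝ] W)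
    (v : Fin (p + q) → T) :
    wedgeAlg A θ η v = (c * (q.factorial : ℝ)⁻¹) •
      altSum (fun w : Fin (p + q) → T => A (g (w ∘ Fin.castAdd q)) (η (w ∘ Fin.natAdd p))) v := by
  have h := altSum_altSum (fun (y : Fin q → T) (u : Fin p → T) => A (g u) (η y))
    (finSumFinEquiv (m := p) (n := q)) v
  have h2 : ∀ w : Fin (p + q) → T, A (θ (w ∘ Fin.castAdd q)) (η (w ∘ Fin.natAdd p)) =
      c • altSum (fun u : Fin p → T => A (g u) (η (w ∘ Fin.natAdd p))) (w ∘ Fin.castAdd q) :=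
    fun w => by rw [hθ, ← LinearMap.flip_apply, map_smul, map_altSum]; rfl
  rw [wedgeAlg_apply, funext h2, altSum_smul]
  refine (congrArg _ (congrArg _ h)).trans ?_
  rw [smul_smul, smul_smul, Fintype.card_fin]
  congr 1
  field_simp

theorem wedgeAlg_altSum_right (A : V →ₗ[ℝ] W →ₗ[ℝ] U) {p q : ℕ} (θ : T [⋀^Fin p]→ₗ[ℝ] V) {c : ℝ}
    {g : (Fin q → T) → W} {η : T [⋀^Fin q]→ₗ[ℝ] W} (hη : ∀ v, η v = c • altSum g v)
    (v : Fin (p + q) → T) :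
    wedgeAlg A θ η v = (c * (p.factorial : ℝ)⁻¹) •
      altSum (fun w : Fin (p + q) → T => A (θ (w ∘ Fin.castAdd q)) (g (w ∘ Fin.natAdd p))) v := by
  -- `altSum_altSum` absorbs the permutations of the left summand, so the blocks are swapped to put
  -- the second factor there.
  have h := altSum_altSum (fun (y : Fin p → T) (u : Fin q → T) => A (θ y) (g u))
    ((Equiv.sumComm _ _).trans (finSumFinEquiv (m := p) (n := q))) v
  have h2 : ∀ w : Fin (p + q) → T, A (θ (w ∘ Fin.castAdd q)) (η (w ∘ Fin.natAdd p)) =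
      c • altSum (fun u : Fin q → T => A (θ (w ∘ Fin.castAdd q)) (g u)) (w ∘ Fin.natAdd p) :=
    fun w => by rw [hη, map_smul, map_altSum]
  rw [wedgeAlg_apply, funext h2, altSum_smul]
  refine (congrArg _ (congrArg _ h)).trans ?_
  rw [smul_smul, smul_smul, Fintype.card_fin]
  congr 1
  field_simp

/-- Both bracketings unfold to `1 / (p! q! r!)` times the same signed sum over three blocks of
arguments. Four different bilinear maps are allowed, so that brackets, actions and evaluation can be
mixed. -/
theorem wedgeAlg_assoc {X Y Z : Type*} [AddCommGroup X] [Module ℝ X] [AddCommGroup Y] [Module ℝ Y]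
    [AddCommGroup Z] [Module ℝ Z] {A : X →ₗ[ℝ] Z →ₗ[ℝ] U} {B : V →ₗ[ℝ] W →ₗ[ℝ] X}
    {A' : V →ₗ[ℝ] Y →ₗ[ℝ] U} {B' : W →ₗ[ℝ] Z →ₗ[ℝ] Y} (h : ∀ x y z, A (B x y) z = A' x (B' y z))
    {p q r : ℕ} (θ : T [⋀^Fin p]→ₗ[ℝ] V) (η : T [⋀^Fin q]→ₗ[ℝ] W) (ζ : T [⋀^Fin r]→ₗ[ℝ] Z)
    (v : Fin (p + q + r) → T) :
    wedgeAlg A (wedgeAlg B θ η) ζ v =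
      wedgeAlg A' θ (wedgeAlg B' η ζ) (v ∘ Fin.cast (Nat.add_assoc p q r).symm) := by
  rw [wedgeAlg_altSum_left A (wedgeAlg_apply B θ η), wedgeAlg_altSum_right A' θ
    (wedgeAlg_apply B' η ζ)]
  congr 1
  · field_simp
  · refine Eq.trans ?_ (altSum_comp_equiv _ (finCongr (Nat.add_assoc p q r).symm) v)
    congr 1
    funext w
    rw [h]
    have e1 : (w ∘ Fin.castAdd r) ∘ Fin.castAdd q =
        (w ∘ finCongr (Nat.add_assoc p q r).symm) ∘ Fin.castAdd (q + r) := rfl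
    have e2 : (w ∘ Fin.castAdd r) ∘ Fin.natAdd p =
        ((w ∘ finCongr (Nat.add_assoc p q r).symm) ∘ Fin.natAdd p) ∘ Fin.castAdd r := rfl
    have e3 : w ∘ Fin.natAdd (p + q) =
        ((w ∘ finCongr (Nat.add_assoc p q r).symm) ∘ Fin.natAdd p) ∘ Fin.natAdd q := by
      funext i
      simp only [Function.comp_apply]
      congr 1
      ext
      simp [Nat.add_assoc]
    rw [e1, e2, e3]

end WedgeFormula

/-! ### Antisymmetrised derivatives of wedge products. -/

section Uncurry

variable {T V W U : Type*} [NormedAddCommGroup T] [NormedSpace ℝ T]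
  [NormedAddCommGroup V] [NormedSpace ℝ V] [FiniteDimensional ℝ V]
  [NormedAddCommGroup W] [NormedSpace ℝ W] [FiniteDimensional ℝ W]
  [NormedAddCommGroup U] [NormedSpace ℝ U] {p q n : ℕ}

/-- The signed sum of the left side is computed twice: it is `(n+1)!` times the value, because the
map is alternating, and `n + 1` times the signed sum on the right, by `altSum_sum_removeNth`. -/
theorem alternatizeUncurryFin_eq_altSum {X : Type*} [NormedAddCommGroup X] [NormedSpace ℝ X]
    (F : T →L[ℝ] T [⋀^Fin n]→L[ℝ] X) (v : Fin (n + 1) → T) :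
    ContinuousAlternatingMap.alternatizeUncurryFin F v =
      (n.factorial : ℝ)⁻¹ • altSum (fun w : Fin (n + 1) → T => F (w 0) (w ∘ Fin.succ)) v := by
  have h1 := altSum_alternatingMap
    (ContinuousAlternatingMap.alternatizeUncurryFin F).toAlternatingMap v
  have h2 := altSum_sum_removeNth (fun x u => F x u) v
  have h3 : ((ContinuousAlternatingMap.alternatizeUncurryFin F).toAlternatingMap :
      (Fin (n + 1) → T) → X) =
      fun w : Fin (n + 1) → T =>
        ∑ i : Fin (n + 1), (-1 : ℝ) ^ (i : ℕ) • F (w i) (i.removeNth w) := by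
    funext w
    refine (ContinuousAlternatingMap.alternatizeUncurryFin_apply F w).trans ?_
    refine Finset.sum_congr rfl fun i _ => ?_
    rw [← Int.cast_smul_eq_zsmul ℝ]
    push_cast
    rfl
  rw [h3, h2, ← h3, Fintype.card_fin, Nat.factorial_succ, Nat.cast_mul, mul_smul] at h1
  have h4 := smul_right_injective X (r := ((n + 1 : ℕ) : ℝ)) (by positivity) h1
  rw [eq_inv_smul_iff₀ (by positivity)]
  exact h4.symm

/-- The differentiation slot already stands in front of the arguments of the first factor, so no
sign appears. -/
theorem alternatizeUncurryFin_wedge_left (B : V →ₗ[ℝ] W →ₗ[ℝ] U) (F : T →L[ℝ] T [⋀^Fin p]→L[ℝ] V)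
    (η : T [⋀^Fin q]→L[ℝ] W) {Φ : T →L[ℝ] T [⋀^Fin (p + q)]→L[ℝ] U}
    (hΦ : ∀ x, Φ x = wedge B (F x) η) (v : Fin (p + q + 1) → T) :
    ContinuousAlternatingMap.alternatizeUncurryFin Φ v =
      wedge B (ContinuousAlternatingMap.alternatizeUncurryFin F) η
        (v ∘ Fin.cast (Nat.add_right_comm p 1 q)) := by
  rw [alternatizeUncurryFin_eq_altSum]
  have h1 := wedgeAlg_altSum_left B
    (θ := (ContinuousAlternatingMap.alternatizeUncurryFin F).toAlternatingMap)
    (alternatizeUncurryFin_eq_altSum F) η.toAlternatingMap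
    (v ∘ Fin.cast (Nat.add_right_comm p 1 q))
  refine Eq.trans ?_ h1.symm
  have h2 : ∀ w : Fin (p + q + 1) → T, Φ (w 0) (w ∘ Fin.succ) =
      ((p.factorial : ℝ) * q.factorial)⁻¹ • altSum (fun u : Fin (p + q) → T =>
        B (F (w 0) (u ∘ Fin.castAdd q)) (η (u ∘ Fin.natAdd p))) (w ∘ Fin.succ) := fun w => by
    rw [hΦ]
    exact wedgeAlg_apply B (F (w 0)).toAlternatingMap η.toAlternatingMap _
  -- The left summand enumerates the slots after the zeroth and the right one is slot zero. Thus the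
  -- permutations in the wedge are absorbed while the differentiation slot stays fixed.
  let e : Fin (p + q) ⊕ Fin 1 ≃ Fin (p + q + 1) := finSumFinEquiv.trans (finRotate (p + q + 1))
  have he1 : ∀ w : Fin (p + q + 1) → T, w ∘ e ∘ Sum.inl = w ∘ Fin.succ := fun w => by
    funext i
    simp only [Function.comp_apply, e, Equiv.trans_apply, finSumFinEquiv_apply_left]
    congr 1
    exact finRotate_of_lt i.2
  have he2 : ∀ w : Fin (p + q + 1) → T, (w ∘ e ∘ Sum.inr) 0 = w 0 := fun w => by
    simp only [Function.comp_apply, e, Equiv.trans_apply, finSumFinEquiv_apply_right]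
    congr 1
    exact finRotate_last'
  have h3 := altSum_altSum (fun (y : Fin 1 → T) (u : Fin (p + q) → T) =>
        B (F (y 0) (u ∘ Fin.castAdd q)) (η (u ∘ Fin.natAdd p))) e v
  simp only [he1, he2] at h3
  rw [funext h2, altSum_smul, h3, smul_smul, smul_smul, Fintype.card_fin]
  congr 1
  · field_simp
  · refine Eq.trans ?_ (altSum_comp_equiv _ (finCongr (Nat.add_right_comm p 1 q)) v)
    congr 1
    funext w
    have e1 : (w ∘ Fin.succ) ∘ Fin.castAdd q = ((w ∘ finCongr (Nat.add_right_comm p 1 q)) ∘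
        Fin.castAdd q) ∘ Fin.succ := by
      funext i; simp only [Function.comp_apply]; congr 1
    have e2 : (w ∘ Fin.succ) ∘ Fin.natAdd p = (w ∘ finCongr (Nat.add_right_comm p 1 q)) ∘
        Fin.natAdd (p + 1) := by
      funext i; simp only [Function.comp_apply]; congr 1; ext; simp; omega
    rw [e1, e2]
    rfl

/-- The differentiation slot must pass the `p` arguments of `θ`; this is the source of `(-1)^p`. -/
theorem alternatizeUncurryFin_wedge_right (B : V →ₗ[ℝ] W →ₗ[ℝ] U) (θ : T [⋀^Fin p]→L[ℝ] V)
    (F : T →L[ℝ] T [⋀^Fin q]→L[ℝ] W) {Φ : T →L[ℝ] T [⋀^Fin (p + q)]→L[ℝ] U}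
    (hΦ : ∀ x, Φ x = wedge B θ (F x)) (v : Fin (p + q + 1) → T) :
    ContinuousAlternatingMap.alternatizeUncurryFin Φ v =
      (-1 : ℝ) ^ p • wedge B θ (ContinuousAlternatingMap.alternatizeUncurryFin F) v := by
  rw [alternatizeUncurryFin_eq_altSum]
  have h1 := wedgeAlg_altSum_right B θ.toAlternatingMap
    (η := (ContinuousAlternatingMap.alternatizeUncurryFin F).toAlternatingMap)
    (alternatizeUncurryFin_eq_altSum F) v
  refine Eq.trans ?_ (congrArg _ h1.symm)
  have h2 : ∀ w : Fin (p + q + 1) → T, Φ (w 0) (w ∘ Fin.succ) =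
      ((p.factorial : ℝ) * q.factorial)⁻¹ • altSum (fun u : Fin (p + q) → T =>
        B (θ (u ∘ Fin.castAdd q)) (F (w 0) (u ∘ Fin.natAdd p))) (w ∘ Fin.succ) := fun w => by
    rw [hΦ]
    exact wedgeAlg_apply B θ.toAlternatingMap (F (w 0)).toAlternatingMap _
  let e : Fin (p + q) ⊕ Fin 1 ≃ Fin (p + q + 1) := finSumFinEquiv.trans (finRotate (p + q + 1))
  have he1 : ∀ w : Fin (p + q + 1) → T, w ∘ e ∘ Sum.inl = w ∘ Fin.succ := fun w => by
    funext i
    simp only [Function.comp_apply, e, Equiv.trans_apply, finSumFinEquiv_apply_left]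
    congr 1
    exact finRotate_of_lt i.2
  have he2 : ∀ w : Fin (p + q + 1) → T, (w ∘ e ∘ Sum.inr) 0 = w 0 := fun w => by
    simp only [Function.comp_apply, e, Equiv.trans_apply, finSumFinEquiv_apply_right]
    congr 1
    exact finRotate_last'
  have h3 := altSum_altSum (fun (y : Fin 1 → T) (u : Fin (p + q) → T) =>
        B (θ (u ∘ Fin.castAdd q)) (F (y 0) (u ∘ Fin.natAdd p))) e v
  simp only [he1, he2] at h3
  rw [funext h2, altSum_smul, h3, smul_smul, smul_smul, Fintype.card_fin]
  -- The cycle attached to position `p` sends each `i < p` to `i + 1`, sends `p` to `0` and fixes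
  -- the later positions; its sign is `(-1)^p`.
  let c : Fin (p + q + 1) := ⟨p, by omega⟩
  have h4 := altSum_comp_perm (fun w : Fin (p + (q + 1)) → T =>
    B (θ (w ∘ Fin.castAdd (q + 1))) (F ((w ∘ Fin.natAdd p) 0) ((w ∘ Fin.natAdd p) ∘ Fin.succ)))
    c.cycleRange v
  rw [Fin.sign_cycleRange] at h4
  push_cast at h4
  have h5 : (fun w : Fin (p + q + 1) → T =>
      B (θ ((w ∘ Fin.succ) ∘ Fin.castAdd q)) (F (w 0) ((w ∘ Fin.succ) ∘ Fin.natAdd p))) =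
      fun w => B (θ ((w ∘ c.cycleRange) ∘ Fin.castAdd (q + 1)))
        (F (((w ∘ c.cycleRange) ∘ Fin.natAdd (m := q + 1) p) 0)
          (((w ∘ c.cycleRange) ∘ Fin.natAdd (m := q + 1) p) ∘ Fin.succ)) := by
    funext w
    have e1 : (w ∘ c.cycleRange) ∘ Fin.castAdd (q + 1) =
        (w ∘ Fin.succ) ∘ Fin.castAdd q := by
      funext i; simp only [Function.comp_apply]; congr 1
      have hi : (Fin.castAdd (q + 1) i : Fin (p + q + 1)) < c := i.2
      refine (Fin.cycleRange_of_lt hi).trans ?_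
      ext
      rw [Fin.val_add_one_of_lt' (by simp; omega)]
      simp
    have e2 : ((w ∘ c.cycleRange) ∘ Fin.natAdd (m := q + 1) p) 0 = w 0 := by
      simp only [Function.comp_apply]; congr 1
      exact Fin.cycleRange_self _
    have e3 : ((w ∘ c.cycleRange) ∘ Fin.natAdd (m := q + 1) p) ∘ Fin.succ =
        (w ∘ Fin.succ) ∘ Fin.natAdd p := by
      funext i; simp only [Function.comp_apply]; congr 1
      have hi : c < (Fin.natAdd p i.succ : Fin (p + q + 1)) := by
        rw [Fin.lt_def]; simp [c]
      exact Fin.cycleRange_of_gt hi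
    rw [← e1, ← e2, ← e3]
  rw [h5]
  refine (congrArg _ h4).trans ?_
  rw [smul_smul, smul_smul]
  congr 1
  simp
  field_simp
  rfl

end Uncurry

/-! ### Calculus of wedge products -/

section WedgeCalculus

variable {T V W U : Type*} [AddCommGroup T] [Module ℝ T] [TopologicalSpace T]
  [NormedAddCommGroup V] [NormedSpace ℝ V] [FiniteDimensional ℝ V]
  [NormedAddCommGroup W] [NormedSpace ℝ W] [FiniteDimensional ℝ W]
  [NormedAddCommGroup U] [NormedSpace ℝ U] {p q : ℕ}

theorem wedge_apply (B : V →ₗ[ℝ] W →ₗ[ℝ] U) (θ : T [⋀^Fin p]→L[ℝ] V) (η : T [⋀^Fin q]→L[ℝ] W)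
    (v : Fin (p + q) → T) :
    wedge B θ η v = ((p.factorial : ℝ) * q.factorial)⁻¹ •
      altSum (fun w : Fin (p + q) → T => B (θ (w ∘ Fin.castAdd q)) (η (w ∘ Fin.natAdd p))) v :=
  wedgeAlg_apply B θ.toAlternatingMap η.toAlternatingMap v

theorem wedge_add_left (B : V →ₗ[ℝ] W →ₗ[ℝ] U) (θ θ' : T [⋀^Fin p]→L[ℝ] V)
    (η : T [⋀^Fin q]→L[ℝ] W) : wedge B (θ + θ') η = wedge B θ η + wedge B θ' η := by
  ext v
  simp only [ContinuousAlternatingMap.add_apply, wedge_apply, map_add, LinearMap.add_apply,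
    altSum_add, smul_add]

theorem wedge_add_right (B : V →ₗ[ℝ] W →ₗ[ℝ] U) (θ : T [⋀^Fin p]→L[ℝ] V)
    (η η' : T [⋀^Fin q]→L[ℝ] W) : wedge B θ (η + η') = wedge B θ η + wedge B θ η' := by
  ext v
  simp only [ContinuousAlternatingMap.add_apply, wedge_apply, map_add, altSum_add, smul_add]

theorem wedge_smul_left (B : V →ₗ[ℝ] W →ₗ[ℝ] U) (c : ℝ) (θ : T [⋀^Fin p]→L[ℝ] V)
    (η : T [⋀^Fin q]→L[ℝ] W) : wedge B (c • θ) η = c • wedge B θ η := by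
  ext v
  simp only [ContinuousAlternatingMap.smul_apply, wedge_apply, map_smul, LinearMap.smul_apply,
    altSum_smul]
  rw [smul_comm]

theorem wedge_smul_right (B : V →ₗ[ℝ] W →ₗ[ℝ] U) (c : ℝ) (θ : T [⋀^Fin p]→L[ℝ] V)
    (η : T [⋀^Fin q]→L[ℝ] W) : wedge B θ (c • η) = c • wedge B θ η := by
  ext v
  simp only [ContinuousAlternatingMap.smul_apply, wedge_apply, map_smul, altSum_smul]
  rw [smul_comm]

theorem wedge_add_bilin (B B' : V →ₗ[ℝ] W →ₗ[ℝ] U) (θ : T [⋀^Fin p]→L[ℝ] V)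
    (η : T [⋀^Fin q]→L[ℝ] W) : wedge (B + B') θ η = wedge B θ η + wedge B' θ η := by
  ext v
  simp only [ContinuousAlternatingMap.add_apply, wedge_apply, LinearMap.add_apply, altSum_add,
    smul_add]

theorem wedge_smul_bilin (c : ℝ) (B : V →ₗ[ℝ] W →ₗ[ℝ] U) (θ : T [⋀^Fin p]→L[ℝ] V)
    (η : T [⋀^Fin q]→L[ℝ] W) : wedge (c • B) θ η = c • wedge B θ η := by
  ext v
  simp only [ContinuousAlternatingMap.smul_apply, wedge_apply, LinearMap.smul_apply, altSum_smul]
  rw [smul_comm]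

theorem wedge_compContinuousLinearMap {T' : Type*} [AddCommGroup T'] [Module ℝ T']
    [TopologicalSpace T'] (B : V →ₗ[ℝ] W →ₗ[ℝ] U) (θ : T [⋀^Fin p]→L[ℝ] V)
    (η : T [⋀^Fin q]→L[ℝ] W) (f : T' →L[ℝ] T) :
    (wedge B θ η).compContinuousLinearMap f =
      wedge B (θ.compContinuousLinearMap f) (η.compContinuousLinearMap f) := by
  ext v
  simp only [ContinuousAlternatingMap.compContinuousLinearMap_apply, wedge_apply]
  rfl

end WedgeCalculus

/-! ### Continuity of the wedge product and the Leibniz rule on a normed space. -/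

section WedgeCLM

variable {T V W U : Type*} [NormedAddCommGroup T] [NormedSpace ℝ T]
  [NormedAddCommGroup V] [NormedSpace ℝ V] [FiniteDimensional ℝ V]
  [NormedAddCommGroup W] [NormedSpace ℝ W] [FiniteDimensional ℝ W]
  [NormedAddCommGroup U] [NormedSpace ℝ U]

/-- Each of the `(p+q)!` terms of the signed sum has the same bound. The exact constant is
immaterial; the estimate makes the wedge a bounded bilinear map, to which the product rule applies.
-/
theorem norm_wedge_le (B : V →ₗ[ℝ] W →ₗ[ℝ] U) {p q : ℕ} (θ : T [⋀^Fin p]→L[ℝ] V)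
    (η : T [⋀^Fin q]→L[ℝ] W) :
    ‖wedge B θ η‖ ≤ ((p.factorial : ℝ) * q.factorial)⁻¹ * (p + q).factorial *
      ‖B.toContinuousBilinearMap‖ * ‖θ‖ * ‖η‖ := by
  refine ContinuousAlternatingMap.opNorm_le_bound _ (by positivity) fun v => ?_
  rw [wedge_apply, norm_smul, Real.norm_of_nonneg (by positivity), mul_assoc, mul_assoc, mul_assoc,
    mul_assoc]
  refine mul_le_mul_of_nonneg_left ?_ (by positivity)
  have key : ∀ σ : Equiv.Perm (Fin (p + q)), ‖((Equiv.Perm.sign σ : ℤ) : ℝ) •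
      B (θ ((v ∘ σ) ∘ Fin.castAdd q)) (η ((v ∘ σ) ∘ Fin.natAdd p))‖ ≤
      ‖B.toContinuousBilinearMap‖ * (‖θ‖ * (‖η‖ * ∏ i, ‖v i‖)) := fun σ => by
    have h1 : ‖((Equiv.Perm.sign σ : ℤ) : ℝ)‖ = 1 := by
      rcases Int.units_eq_one_or (Equiv.Perm.sign σ) with h | h <;> simp [h]
    rw [norm_smul, h1, one_mul]
    have h2 := B.toContinuousBilinearMap.le_opNorm₂ (θ ((v ∘ σ) ∘ Fin.castAdd q))
      (η ((v ∘ σ) ∘ Fin.natAdd p))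
    have h3 : ∏ i, ‖v i‖ = (∏ i, ‖((v ∘ σ) ∘ Fin.castAdd q) i‖) *
        ∏ i, ‖((v ∘ σ) ∘ Fin.natAdd p) i‖ := by
      rw [← Equiv.prod_comp σ, Fin.prod_univ_add]
      rfl
    refine h2.trans ?_
    rw [mul_assoc]
    refine mul_le_mul_of_nonneg_left ?_ (by positivity)
    refine (mul_le_mul (θ.le_opNorm _) (η.le_opNorm _) (norm_nonneg _) (by positivity)).trans ?_
    rw [h3]
    apply le_of_eq
    ring
  refine (norm_sum_le _ _).trans ((Finset.sum_le_sum fun σ _ => key σ).trans ?_)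
  rw [Finset.sum_const, Finset.card_univ, Fintype.card_perm, Fintype.card_fin, nsmul_eq_mul]

/-- The wedge product as a continuous bilinear map. -/
def wedgeCLM (T : Type*) [NormedAddCommGroup T] [NormedSpace ℝ T] (B : V →ₗ[ℝ] W →ₗ[ℝ] U)
    (p q : ℕ) :
    (T [⋀^Fin p]→L[ℝ] V) →L[ℝ] (T [⋀^Fin q]→L[ℝ] W) →L[ℝ] (T [⋀^Fin (p + q)]→L[ℝ] U) :=
  LinearMap.mkContinuous₂ (LinearMap.mk₂ ℝ (wedge B) (wedge_add_left B) (wedge_smul_left B)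
    (wedge_add_right B) (fun c θ η => wedge_smul_right B c θ η)) _ (norm_wedge_le B)

/-- The Leibniz rule for the exterior derivative on a normed space. -/
theorem extDeriv_wedge (B : V →ₗ[ℝ] W →ₗ[ℝ] U) {p q : ℕ} {θ : T → T [⋀^Fin p]→L[ℝ] V}
    {η : T → T [⋀^Fin q]→L[ℝ] W} {x : T} (hθ : DifferentiableAt ℝ θ x)
    (hη : DifferentiableAt ℝ η x) (v : Fin (p + q + 1) → T) :
    extDeriv (fun y => wedge B (θ y) (η y)) x v =
      wedge B (extDeriv θ x) (η x) (v ∘ Fin.cast (Nat.add_right_comm p 1 q)) +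
        (-1 : ℝ) ^ p • wedge B (θ x) (extDeriv η x) v := by
  have h := (wedgeCLM T B p q).hasFDerivAt_of_bilinear hθ.hasFDerivAt hη.hasFDerivAt
  have h1 : fderiv ℝ (fun y => wedge B (θ y) (η y)) x = _ := h.fderiv
  rw [extDeriv, h1, ContinuousAlternatingMap.alternatizeUncurryFin_add,
    ContinuousAlternatingMap.add_apply]
  -- The product rule lists the term with the derivative of `η` first.
  refine (add_comm _ _).trans ?_
  congr 1
  · exact alternatizeUncurryFin_wedge_left B (fderiv ℝ θ x) (η x) (fun _ => rfl) v
  · exact alternatizeUncurryFin_wedge_right B (θ x) (fderiv ℝ η x) (fun _ => rfl) v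

end WedgeCLM

/-! ### Transport of degrees -/

section CastDeg

@[simp]
theorem castDeg_castDeg (A : ℕ → Type*) {p q r : ℕ} (h : p = q) (h' : q = r) (x : A p) :
    castDeg A h' (castDeg A h x) = castDeg A (h.trans h') x := by
  subst h h'; rfl

variable {A : ℕ → Type*} [∀ p, AddCommGroup (A p)] [∀ p, Module ℝ (A p)] {p q : ℕ}

theorem castDeg_add (h : p = q) (x y : A p) :
    castDeg A h (x + y) = castDeg A h x + castDeg A h y := by subst h; rfl

theorem castDeg_sub (h : p = q) (x y : A p) :
    castDeg A h (x - y) = castDeg A h x - castDeg A h y := by subst h; rfl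

theorem castDeg_smul (h : p = q) (c : ℝ) (x : A p) :
    castDeg A h (c • x) = c • castDeg A h x := by subst h; rfl

end CastDeg

/-! ### Wedge products of forms in a prescribed degree -/

namespace PreForm

variable {E : Type*} [NormedAddCommGroup E] [NormedSpace ℝ E]
  {M : Type*} [TopologicalSpace M] [ChartedSpace E M]
  {E' : Type*} [NormedAddCommGroup E'] [NormedSpace ℝ E']
  {N : Type*} [TopologicalSpace N] [ChartedSpace E' N]
  {V : Type*} [NormedAddCommGroup V] [NormedSpace ℝ V] [FiniteDimensional ℝ V]
  {W : Type*} [NormedAddCommGroup W] [NormedSpace ℝ W] [FiniteDimensional ℝ W]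
  {U : Type*} [NormedAddCommGroup U] [NormedSpace ℝ U]
  {X : Type*} [NormedAddCommGroup X] [NormedSpace ℝ X]
  {Z : Type*} [NormedAddCommGroup Z] [NormedSpace ℝ Z]
  {p q r n m : ℕ}

theorem castDeg_apply (h : p = q) (θ : PreForm E M X p) (x : M)
    (v : Fin q → TangentSpace 𝓘(ℝ, E) x) :
    castDeg (PreForm E M X) h θ x v = θ x (v ∘ Fin.cast h) := by
  subst h; rfl

/-- The wedge product of a `p`-form and a `q`-form, as a form of degree `n = p + q`. -/
def wedgeTo (B : V →ₗ[ℝ] W →ₗ[ℝ] U) (θ : PreForm E M V p) (η : PreForm E M W q) (h : p + q = n) :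
    PreForm E M U n :=
  castDeg (PreForm E M U) h (θ.wedge B η)

variable (B : V →ₗ[ℝ] W →ₗ[ℝ] U)

theorem castDeg_wedgeTo (θ : PreForm E M V p) (η : PreForm E M W q) (h : p + q = n) (h' : n = m) :
    castDeg (PreForm E M U) h' (θ.wedgeTo B η h) = θ.wedgeTo B η (h.trans h') := by
  simp [wedgeTo]

theorem wedgeTo_add_left (θ θ' : PreForm E M V p) (η : PreForm E M W q) (h : p + q = n) :
    (θ + θ').wedgeTo B η h = θ.wedgeTo B η h + θ'.wedgeTo B η h := by
  subst h; exact funext fun x => wedge_add_left B (θ x) (θ' x) (η x)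

theorem wedgeTo_add_right (θ : PreForm E M V p) (η η' : PreForm E M W q) (h : p + q = n) :
    θ.wedgeTo B (η + η') h = θ.wedgeTo B η h + θ.wedgeTo B η' h := by
  subst h; exact funext fun x => wedge_add_right B (θ x) (η x) (η' x)

theorem wedgeTo_smul_left (c : ℝ) (θ : PreForm E M V p) (η : PreForm E M W q) (h : p + q = n) :
    (c • θ).wedgeTo B η h = c • θ.wedgeTo B η h := by
  subst h; exact funext fun x => wedge_smul_left B c (θ x) (η x)

theorem wedgeTo_smul_right (c : ℝ) (θ : PreForm E M V p) (η : PreForm E M W q) (h : p + q = n) :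
    θ.wedgeTo B (c • η) h = c • θ.wedgeTo B η h := by
  subst h; exact funext fun x => wedge_smul_right B c (θ x) (η x)

theorem wedgeTo_sub_left (θ θ' : PreForm E M V p) (η : PreForm E M W q) (h : p + q = n) :
    (θ - θ').wedgeTo B η h = θ.wedgeTo B η h - θ'.wedgeTo B η h := by
  rw [sub_eq_add_neg, ← neg_one_smul ℝ θ', wedgeTo_add_left, wedgeTo_smul_left, neg_one_smul,
    ← sub_eq_add_neg]

theorem wedgeTo_sub_right (θ : PreForm E M V p) (η η' : PreForm E M W q) (h : p + q = n) :
    θ.wedgeTo B (η - η') h = θ.wedgeTo B η h - θ.wedgeTo B η' h := by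
  rw [sub_eq_add_neg, ← neg_one_smul ℝ η', wedgeTo_add_right, wedgeTo_smul_right, neg_one_smul,
    ← sub_eq_add_neg]

theorem wedgeTo_add_bilin (B' : V →ₗ[ℝ] W →ₗ[ℝ] U) (θ : PreForm E M V p) (η : PreForm E M W q)
    (h : p + q = n) : θ.wedgeTo (B + B') η h = θ.wedgeTo B η h + θ.wedgeTo B' η h := by
  subst h; exact funext fun x => wedge_add_bilin B B' (θ x) (η x)

theorem wedgeTo_smul_bilin (c : ℝ) (θ : PreForm E M V p) (η : PreForm E M W q)
    (h : p + q = n) : θ.wedgeTo (c • B) η h = c • θ.wedgeTo B η h := by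
  subst h; exact funext fun x => wedge_smul_bilin c B (θ x) (η x)

theorem wedgeTo_neg_bilin (θ : PreForm E M V p) (η : PreForm E M W q) (h : p + q = n) :
    θ.wedgeTo (-B) η h = -θ.wedgeTo B η h := by
  rw [← neg_one_smul ℝ B, wedgeTo_smul_bilin, neg_one_smul]

theorem wedgeTo_sub_bilin (B' : V →ₗ[ℝ] W →ₗ[ℝ] U) (θ : PreForm E M V p) (η : PreForm E M W q)
    (h : p + q = n) : θ.wedgeTo (B - B') η h = θ.wedgeTo B η h - θ.wedgeTo B' η h := by
  rw [sub_eq_add_neg, wedgeTo_add_bilin, wedgeTo_neg_bilin, ← sub_eq_add_neg]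

theorem mapValues_wedgeTo [FiniteDimensional ℝ U] (L : U →ₗ[ℝ] X) (θ : PreForm E M V p)
    (η : PreForm E M W q) (h : p + q = n) :
    (θ.wedgeTo B η h).mapValues L = θ.wedgeTo (B.compr₂ L) η h := by
  subst h
  funext x
  ext v
  change L (GForms.wedge B (θ x) (η x) v) = GForms.wedge (B.compr₂ L) (θ x) (η x) v
  rw [wedge_apply, wedge_apply, map_smul, map_altSum]
  rfl

theorem wedgeTo_mapValues_left [FiniteDimensional ℝ X] (L : X →ₗ[ℝ] V) (θ : PreForm E M X p)
    (η : PreForm E M W q) (h : p + q = n) :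
    (θ.mapValues L).wedgeTo B η h = θ.wedgeTo (B ∘ₗ L) η h := by
  subst h
  funext x
  ext v
  change GForms.wedge B _ (η x) v = GForms.wedge (B ∘ₗ L) (θ x) (η x) v
  rw [wedge_apply, wedge_apply]
  rfl

theorem wedgeTo_mapValues_right [FiniteDimensional ℝ X] (L : X →ₗ[ℝ] W) (θ : PreForm E M V p)
    (η : PreForm E M X q) (h : p + q = n) :
    θ.wedgeTo B (η.mapValues L) h = θ.wedgeTo (B.compl₂ L) η h := by
  subst h
  funext x
  ext v
  change GForms.wedge B (θ x) _ v = GForms.wedge (B.compl₂ L) (θ x) (η x) v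
  rw [wedge_apply, wedge_apply]
  rfl

theorem pullback_wedgeTo (f : M → N) (θ : PreForm E' N V p) (η : PreForm E' N W q)
    (h : p + q = n) :
    pullback (E := E) f (θ.wedgeTo B η h) = (pullback f θ).wedgeTo B (pullback f η) h := by
  subst h
  exact funext fun x => wedge_compContinuousLinearMap B (θ (f x)) (η (f x)) _

theorem pullback_mapValues (f : M → N) (L : V →ₗ[ℝ] X) (θ : PreForm E' N V p) :
    pullback (E := E) f (θ.mapValues L) = (pullback f θ).mapValues L := rfl

theorem pullback_sub (f : M → N) (θ η : PreForm E' N X p) :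
    pullback (E := E) f (θ - η) = pullback f θ - pullback f η := rfl

theorem mapValues_sub (L : V →ₗ[ℝ] X) (θ η : PreForm E M V p) :
    mapValues L (θ - η) = mapValues L θ - mapValues L η := by
  funext x; ext v; simp [mapValues]

/-- Graded commutativity of the wedge product. -/
theorem wedgeTo_comm (θ : PreForm E M V p) (η : PreForm E M W q) (h : p + q = n) :
    θ.wedgeTo B η h = (-1 : ℝ) ^ (p * q) • η.wedgeTo B.flip θ ((Nat.add_comm q p).trans h) := by
  subst h
  funext x
  ext v
  have h1 := wedgeAlg_comm B (θ x).toAlternatingMap (η x).toAlternatingMap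
    (v ∘ Fin.cast (Nat.add_comm q p))
  rw [wedgeTo, wedgeTo, Pi.smul_apply, ContinuousAlternatingMap.smul_apply, castDeg_apply,
    castDeg_apply, Nat.mul_comm p q]
  exact h1

/-- Associativity of the wedge product. -/
theorem wedgeTo_assoc [FiniteDimensional ℝ X] [FiniteDimensional ℝ Z] [FiniteDimensional ℝ U]
    {Y : Type*} [NormedAddCommGroup Y] [NormedSpace ℝ Y]
    {A : U →ₗ[ℝ] Z →ₗ[ℝ] Y} {A' : V →ₗ[ℝ] X →ₗ[ℝ] Y} {B : V →ₗ[ℝ] W →ₗ[ℝ] U}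
    {B' : W →ₗ[ℝ] Z →ₗ[ℝ] X} (hB : ∀ x y z, A (B x y) z = A' x (B' y z))
    (θ : PreForm E M V p) (η : PreForm E M W q) (ζ : PreForm E M Z r) {l : ℕ}
    (h : p + q = n) (h' : n + r = l) (k : q + r = m) (k' : p + m = l) :
    (θ.wedgeTo B η h).wedgeTo A ζ h' = θ.wedgeTo A' (η.wedgeTo B' ζ k) k' := by
  subst h k h'
  funext x
  ext v
  have h1 := wedgeAlg_assoc hB (θ x).toAlternatingMap (η x).toAlternatingMap
    (ζ x).toAlternatingMap v
  refine Eq.trans ?_ (h1.trans ?_)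
  · rfl
  · exact (castDeg_apply k' (θ.wedge A' (η.wedge B' ζ)) x v).symm

/-- The graded version of the rule `[X, Y] • Z = X • (Y • Z) - Y • (X • Z)` for an action. -/
theorem wedgeTo_action {C : V →ₗ[ℝ] V →ₗ[ℝ] V} {A : V →ₗ[ℝ] W →ₗ[ℝ] W}
    (hA : ∀ x y z, A (C x y) z = A x (A y z) - A y (A x z))
    (θ : PreForm E M V p) (η : PreForm E M V q) (ζ : PreForm E M W r) {l m' : ℕ}
    (h : p + q = n) (h' : n + r = l) (k : q + r = m) (k' : p + m = l)
    (j : p + r = m') (j' : q + m' = l) :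
    (θ.wedgeTo C η h).wedgeTo A ζ h' = θ.wedgeTo A (η.wedgeTo A ζ k) k' -
      (-1 : ℝ) ^ (p * q) • η.wedgeTo A (θ.wedgeTo A ζ j) j' := by
  -- Compositions `A x ∘ A y` are treated as coefficients in the endomorphisms of `W`, and acting on
  -- `ζ` becomes a wedge with respect to evaluation. Continuous endomorphisms are used because
  -- coefficient spaces carry a norm.
  let ev : (W →L[ℝ] W) →ₗ[ℝ] W →ₗ[ℝ] W := ContinuousLinearMap.coeLM ℝ
  let D : V →ₗ[ℝ] V →ₗ[ℝ] (W →L[ℝ] W) := LinearMap.mk₂ ℝ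
    (fun x y => LinearMap.toContinuousLinearMap (A x ∘ₗ A y))
    (fun _ _ _ => by ext; simp) (fun _ _ _ => by ext; simp) (fun _ _ _ => by ext; simp)
    (fun _ _ _ => by ext; simp)
  have h1 : θ.wedgeTo A (η.wedgeTo A ζ k) k' = (θ.wedgeTo D η h).wedgeTo ev ζ h' :=
    (wedgeTo_assoc (fun _ _ _ => rfl) θ η ζ h h' k k').symm
  have h2 : η.wedgeTo A (θ.wedgeTo A ζ j) j' =
      (η.wedgeTo D θ ((Nat.add_comm q p).trans h)).wedgeTo ev ζ h' :=
    (wedgeTo_assoc (fun _ _ _ => rfl) η θ ζ _ h' j j').symm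
  -- The hypothesis `hA` says that `A ∘ C` is the commutator `D - D.flip`. Graded commutativity then
  -- turns the flipped term into the one with `η` in front.
  have h3 : (θ.wedgeTo C η h).wedgeTo A ζ h' = (θ.wedgeTo (D - D.flip) η h).wedgeTo ev ζ h' := by
    have e1 : A = ev ∘ₗ (LinearMap.toContinuousLinearMap.toLinearMap ∘ₗ A) := rfl
    rw [e1, ← wedgeTo_mapValues_left, mapValues_wedgeTo]
    congr 2
    ext x y z
    exact hA x y z
  rw [h1, h2, h3, wedgeTo_sub_bilin, wedgeTo_sub_left, wedgeTo_comm D η θ, wedgeTo_smul_left,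
    smul_smul, Nat.mul_comm q p, ← mul_pow]
  simp

end PreForm

/-! ### Smoothness of pullbacks on normed spaces -/

section Pullback

variable {E F V : Type*} [NormedAddCommGroup E] [NormedSpace ℝ E] [NormedAddCommGroup F]
  [NormedSpace ℝ F] [NormedAddCommGroup V] [NormedSpace ℝ V] {p : ℕ}

/-- A continuous linear left inverse of the inclusion of alternating into multilinear maps. -/
def alternatizationCLM (E V : Type*) [NormedAddCommGroup E] [NormedSpace ℝ E]
    [NormedAddCommGroup V] [NormedSpace ℝ V] (p : ℕ) :
    ContinuousMultilinearMap ℝ (fun _ : Fin p => E) V →L[ℝ] E [⋀^Fin p]→L[ℝ] V :=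
  LinearMap.mkContinuous
    { toFun f := (p.factorial : ℝ)⁻¹ • ContinuousMultilinearMap.alternatization f
      map_add' f g := by rw [map_add, smul_add]
      map_smul' c f := by
        ext v
        simp [ContinuousMultilinearMap.alternatization_apply_apply, Finset.smul_sum,
          smul_comm c] }
    1 fun f => by
      refine ContinuousAlternatingMap.opNorm_le_bound _ (by positivity) fun v => ?_
      change ‖(p.factorial : ℝ)⁻¹ • ContinuousMultilinearMap.alternatization f v‖ ≤ _
      rw [norm_smul, ContinuousMultilinearMap.alternatization_apply_apply,
        Real.norm_of_nonneg (by positivity)]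
      have key : ∀ σ : Equiv.Perm (Fin p), ‖Equiv.Perm.sign σ • f (v ∘ σ)‖ ≤ ‖f‖ * ∏ i, ‖v i‖ :=
        fun σ => by
          have h1 : ‖Equiv.Perm.sign σ • f (v ∘ σ)‖ = ‖f (v ∘ σ)‖ := by
            rcases Int.units_eq_one_or (Equiv.Perm.sign σ) with h | h <;> simp [h]
          rw [h1, ← Equiv.prod_comp σ]
          exact f.le_opNorm _
      have h2 := (norm_sum_le Finset.univ fun σ : Equiv.Perm (Fin p) =>
        Equiv.Perm.sign σ • f (v ∘ σ)).trans (Finset.sum_le_sum fun σ _ => key σ)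
      rw [Finset.sum_const, Finset.card_univ, Fintype.card_perm, Fintype.card_fin,
        nsmul_eq_mul] at h2
      rw [one_mul, inv_mul_le_iff₀ (by positivity)]
      exact h2

/-- The factor `1 / p!` compensates for the `p!` equal terms in the antisymmetrisation of an
alternating map. -/
theorem alternatizationCLM_coe (θ : E [⋀^Fin p]→L[ℝ] V) :
    alternatizationCLM E V p θ.toContinuousMultilinearMap = θ := by
  ext v
  have h := altSum_alternatingMap θ.toAlternatingMap v
  rw [Fintype.card_fin] at h
  change (p.factorial : ℝ)⁻¹ •
    ContinuousMultilinearMap.alternatization θ.toContinuousMultilinearMap v = _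
  rw [inv_smul_eq_iff₀ (by positivity), ContinuousMultilinearMap.alternatization_apply_apply]
  refine Eq.trans (Finset.sum_congr rfl fun σ _ => ?_) h
  rw [Units.smul_def, ← Int.cast_smul_eq_zsmul ℝ]
  rfl

/-- Precomposition of multilinear maps is continuous and multilinear in the `p` linear maps, hence
smooth. The alternating case follows by including into multilinear maps and returning with
`alternatizationCLM`. -/
theorem contDiffOn_compContinuousLinearMap {X : Type*} [NormedAddCommGroup X] [NormedSpace ℝ X]
    {n : WithTop ℕ∞} {φ : X → F [⋀^Fin p]→L[ℝ] V} {A : X → E →L[ℝ] F} {s : Set X}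
    (hφ : ContDiffOn ℝ n φ s) (hA : ContDiffOn ℝ n A s) :
    ContDiffOn ℝ n (fun x => (φ x).compContinuousLinearMap (A x)) s := by
  have h1 : ContDiffOn ℝ n (fun x =>
      ContinuousMultilinearMap.compContinuousLinearMapContinuousMultilinear ℝ
        (fun _ : Fin p => E) (fun _ : Fin p => F) V (fun _ => A x)) s :=
    (ContinuousMultilinearMap.contDiff _).comp_contDiffOn (contDiffOn_pi.2 fun _ => hA)
  have h2 : ContDiffOn ℝ n (fun x => (φ x).toContinuousMultilinearMap) s :=
    (ContinuousAlternatingMap.toContinuousMultilinearMapCLM (𝕜 := ℝ) (E := F) (F := V)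
      (ι := Fin p) ℝ).contDiff.comp_contDiffOn hφ
  refine ((alternatizationCLM E V p).contDiff.comp_contDiffOn (h1.clm_apply h2)).congr
    fun x _ => ?_
  exact (alternatizationCLM_coe ((φ x).compContinuousLinearMap (A x))).symm

end Pullback

/-! ### Pullbacks, smooth forms and the exterior derivative on manifolds -/

namespace PreForm

variable {E : Type*} [NormedAddCommGroup E] [NormedSpace ℝ E]
  {M : Type*} [TopologicalSpace M] [ChartedSpace E M]
  {E' : Type*} [NormedAddCommGroup E'] [NormedSpace ℝ E']
  {N : Type*} [TopologicalSpace N] [ChartedSpace E' N]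
  {E'' : Type*} [NormedAddCommGroup E''] [NormedSpace ℝ E'']
  {Q : Type*} [TopologicalSpace Q] [ChartedSpace E'' Q]
  {V : Type*} [NormedAddCommGroup V] [NormedSpace ℝ V]
  {W : Type*} [NormedAddCommGroup W] [NormedSpace ℝ W]
  {U : Type*} [NormedAddCommGroup U] [NormedSpace ℝ U] {p q n : ℕ}

/-- A form on the normed space `E`, seen as a form on the manifold `E`. -/
def ofFun (φ : E → E [⋀^Fin p]→L[ℝ] V) : PreForm E E V p := φ

/-- The differentiability order needed for the symmetry of second derivatives, on which both
naturality of `d` and `d² = 0` rest. -/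
theorem minSmoothness_two_le : minSmoothness ℝ 2 ≤ (∞ : WithTop ℕ∞) := by
  rw [minSmoothness_of_isRCLikeNormedField]
  exact WithTop.coe_le_coe.2 (le_top : (2 : ℕ∞) ≤ ⊤)

theorem pullback_comp_apply {f : M → N} {g : N → Q} (θ : PreForm E'' Q V p) {x : M}
    (hg : MDifferentiableAt 𝓘(ℝ, E') 𝓘(ℝ, E'') g (f x))
    (hf : MDifferentiableAt 𝓘(ℝ, E) 𝓘(ℝ, E') f x) :
    pullback (E := E) (g ∘ f) θ x = pullback (E := E) f (pullback (E := E') g θ) x := by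
  rw [pullback, mfderiv_comp x hg hf]
  rfl

theorem pullback_congr {f g : M → N} (θ : PreForm E' N V p) {x : M} (h : f =ᶠ[𝓝 x] g) :
    pullback (E := E) f θ x = pullback g θ x := by
  -- The type of `θ y` depends on `y` through the tangent space. Giving it the constant model space
  -- makes rewriting the base point possible.
  let θ' : N → E' [⋀^Fin p]→L[ℝ] V := θ
  have h1 : mfderiv 𝓘(ℝ, E) 𝓘(ℝ, E') f x = mfderiv 𝓘(ℝ, E) 𝓘(ℝ, E') g x := h.mfderiv_eq
  have h2 : θ' (f x) = θ' (g x) := by rw [h.eq_of_nhds]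
  change (θ' (f x)).compContinuousLinearMap (mfderiv 𝓘(ℝ, E) 𝓘(ℝ, E') f x : E →L[ℝ] E') =
    (θ' (g x)).compContinuousLinearMap (mfderiv 𝓘(ℝ, E) 𝓘(ℝ, E') g x : E →L[ℝ] E')
  rw [h2]
  congr 1

theorem pullback_id (θ : PreForm E M V p) : pullback (E := E) id θ = θ := by
  funext x
  rw [pullback, mfderiv_id]
  rfl

theorem pullback_comp {f : M → N} {g : N → Q} (θ : PreForm E'' Q V p)
    (hg : ContMDiff 𝓘(ℝ, E') 𝓘(ℝ, E'') ∞ g) (hf : ContMDiff 𝓘(ℝ, E) 𝓘(ℝ, E') ∞ f) :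
    pullback (E := E) (g ∘ f) θ = pullback (E := E) f (pullback (E := E') g θ) :=
  funext fun x => pullback_comp_apply θ (hg.mdifferentiable (by simp) _)
    (hf.mdifferentiable (by simp) _)

section Manifold

variable [IsManifold 𝓘(ℝ, E) ∞ M] [IsManifold 𝓘(ℝ, E') ∞ N]

theorem mdifferentiableAt_atlas {e : OpenPartialHomeomorph M E} (he : e ∈ atlas E M) {x : M}
    (hx : x ∈ e.source) : MDifferentiableAt 𝓘(ℝ, E) 𝓘(ℝ, E) e x :=
  ((contMDiffOn_of_mem_maximalAtlas (n := ∞) (IsManifold.subset_maximalAtlas he)).contMDiffAt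
    (e.open_source.mem_nhds hx)).mdifferentiableAt (by simp)

theorem mdifferentiableAt_atlas_symm {e : OpenPartialHomeomorph M E} (he : e ∈ atlas E M) {y : E}
    (hy : y ∈ e.target) : MDifferentiableAt 𝓘(ℝ, E) 𝓘(ℝ, E) e.symm y :=
  ((contMDiffOn_symm_of_mem_maximalAtlas (n := ∞)
    (IsManifold.subset_maximalAtlas he)).contMDiffAt
    (e.open_target.mem_nhds hy)).mdifferentiableAt (by simp)

/-- The domain on which a map is expressed in a pair of charts. -/
def chartDomain (f : M → N) (e : OpenPartialHomeomorph M E) (e' : OpenPartialHomeomorph N E') :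
    Set E :=
  e.target ∩ (f ∘ e.symm) ⁻¹' e'.source

theorem isOpen_chartDomain {f : M → N} (hf : Continuous f) (e : OpenPartialHomeomorph M E)
    (e' : OpenPartialHomeomorph N E') : IsOpen (chartDomain f e e') :=
  (hf.comp_continuousOn e.continuousOn_symm).isOpen_inter_preimage e.open_target e'.open_source

theorem contDiffOn_inCharts {f : M → N} (hf : ContMDiff 𝓘(ℝ, E) 𝓘(ℝ, E') ∞ f)
    {e : OpenPartialHomeomorph M E} (he : e ∈ atlas E M)
    {e' : OpenPartialHomeomorph N E'} (he' : e' ∈ atlas E' N) :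
    ContDiffOn ℝ ∞ (e' ∘ f ∘ e.symm) (chartDomain f e e') := by
  rw [← contMDiffOn_iff_contDiffOn]
  exact (contMDiffOn_of_mem_maximalAtlas (IsManifold.subset_maximalAtlas he')).comp
    (hf.comp_contMDiffOn ((contMDiffOn_symm_of_mem_maximalAtlas
      (IsManifold.subset_maximalAtlas he)).mono Set.inter_subset_left)) fun _ h => h.2

/-- Near `y` the map `f ∘ e.symm` factors as `e'.symm` after the coordinate expression of `f`, so
functoriality of pullback applies. -/
theorem inChart_pullback {f : M → N} (hf : ContMDiff 𝓘(ℝ, E) 𝓘(ℝ, E') ∞ f)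
    (θ : PreForm E' N V p) {e : OpenPartialHomeomorph M E} (he : e ∈ atlas E M)
    {e' : OpenPartialHomeomorph N E'} (he' : e' ∈ atlas E' N) {y : E}
    (hy : y ∈ chartDomain f e e') :
    (pullback (E := E) f θ).inChart e y =
      (θ.inChart e' ((e' ∘ f ∘ e.symm) y)).compContinuousLinearMap
        (fderiv ℝ (e' ∘ f ∘ e.symm) y) := by
  have h1 : MDifferentiableAt 𝓘(ℝ, E) 𝓘(ℝ, E') (f ∘ e.symm) y :=
    (hf.mdifferentiable (by simp) _).comp y (mdifferentiableAt_atlas_symm he hy.1)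
  have h2 : MDifferentiableAt 𝓘(ℝ, E) 𝓘(ℝ, E') (e' ∘ f ∘ e.symm) y :=
    MDifferentiableAt.comp y (mdifferentiableAt_atlas he' hy.2) h1
  have h3 : f ∘ e.symm =ᶠ[𝓝 y] e'.symm ∘ (e' ∘ f ∘ e.symm) := by
    filter_upwards [(isOpen_chartDomain hf.continuous e e').mem_nhds hy] with z hz
    exact (e'.left_inv hz.2).symm
  have h4 : pullback (E := E) (f ∘ e.symm) θ y =
      pullback (E := E) (e' ∘ f ∘ e.symm) (pullback (E := E') e'.symm θ) y :=
    (pullback_congr θ h3).trans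
      (pullback_comp_apply θ (mdifferentiableAt_atlas_symm he' (e'.map_source hy.2)) h2)
  rw [pullback_comp_apply θ (hf.mdifferentiable (by simp) _)
    (mdifferentiableAt_atlas_symm he hy.1)] at h4
  refine Eq.trans h4 ?_
  rw [pullback, mfderiv_eq_fderiv]
  rfl

/-- A form is recovered from its expression in a chart. -/
theorem pullback_inChart (θ : PreForm E M V p) {e : OpenPartialHomeomorph M E}
    (he : e ∈ atlas E M) {x : M} (hx : x ∈ e.source) :
    pullback (E := E) e (ofFun (θ.inChart e)) x = θ x := by
  have h1 : (e.symm ∘ e : M → M) =ᶠ[𝓝 x] id := by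
    filter_upwards [e.open_source.mem_nhds hx] with z hz
    exact e.left_inv hz
  refine (pullback_comp_apply θ (mdifferentiableAt_atlas_symm he (e.map_source hx))
    (mdifferentiableAt_atlas he hx)).symm.trans ?_
  rw [pullback_congr θ h1, pullback_id]

/-- Smoothness is local: around each point a chart at its image is used, and there the pullback is a
composition with the derivative of a smooth map. -/
theorem IsSmooth.pullback {f : M → N} (hf : ContMDiff 𝓘(ℝ, E) 𝓘(ℝ, E') ∞ f)
    {θ : PreForm E' N V p} (hθ : θ.IsSmooth) : (PreForm.pullback (E := E) f θ).IsSmooth := by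
  intro e he y hy
  let e' := chartAt E' (f (e.symm y))
  have he' : e' ∈ atlas E' N := chart_mem_atlas _ _
  have hy' : y ∈ chartDomain f e e' := ⟨hy, mem_chart_source _ _⟩
  have ho := isOpen_chartDomain hf.continuous e e'
  have h1 := contDiffOn_inCharts hf he he'
  have h2 : ContDiffOn ℝ ∞ (fun y => (θ.inChart e' ((e' ∘ f ∘ e.symm) y)).compContinuousLinearMap
      (fderiv ℝ (e' ∘ f ∘ e.symm) y)) (chartDomain f e e') :=
    contDiffOn_compContinuousLinearMap ((hθ e' he').comp h1 fun z hz => e'.map_source hz.2)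
      (h1.fderiv_of_isOpen ho le_rfl)
  exact ((h2.congr fun z hz => inChart_pullback hf θ he he' hz).contDiffAt
    (ho.mem_nhds hy')).contDiffWithinAt

theorem IsSmooth.differentiableAt {θ : PreForm E M V p} (hθ : θ.IsSmooth)
    {e : OpenPartialHomeomorph M E} (he : e ∈ atlas E M) {y : E} (hy : y ∈ e.target) :
    DifferentiableAt ℝ (θ.inChart e) y :=
  ((hθ e he).contDiffAt (e.open_target.mem_nhds hy)).differentiableAt (by simp)

/-- Naturality of `d` on normed spaces, transported to arbitrary charts `e` and `e'`. With `f = id`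
it shows that `d` does not depend on the chart; with the preferred charts it shows that `d` commutes
with pullback. -/
theorem pullback_extDeriv_inChart {f : M → N} (hf : ContMDiff 𝓘(ℝ, E) 𝓘(ℝ, E') ∞ f)
    {θ : PreForm E' N V p} (hθ : θ.IsSmooth) {e : OpenPartialHomeomorph M E} (he : e ∈ atlas E M)
    {e' : OpenPartialHomeomorph N E'} (he' : e' ∈ atlas E' N) {x : M} (hx : x ∈ e.source)
    (hx' : f x ∈ e'.source) :
    pullback (E := E) e (ofFun (extDeriv ((pullback (E := E) f θ).inChart e))) x =
      pullback (E := E) f (pullback (E := E') e' (ofFun (extDeriv (θ.inChart e')))) x := by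
  have hy : e x ∈ chartDomain f e e' :=
    ⟨e.map_source hx, by simpa [e.left_inv hx] using hx'⟩
  have ho := isOpen_chartDomain hf.continuous e e'
  have h1 : (pullback (E := E) f θ).inChart e =ᶠ[𝓝 (e x)]
      fun y => (θ.inChart e' ((e' ∘ f ∘ e.symm) y)).compContinuousLinearMap
        (fderiv ℝ (e' ∘ f ∘ e.symm) y) := by
    filter_upwards [ho.mem_nhds hy] with y hy
    exact inChart_pullback hf θ he he' hy
  have hg : ContDiffAt ℝ ∞ (e' ∘ f ∘ e.symm) (e x) :=
    (contDiffOn_inCharts hf he he').contDiffAt (ho.mem_nhds hy)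
  have hz : (e' ∘ f ∘ e.symm) (e x) ∈ e'.target := e'.map_source hy.2
  have h2 := h1.extDeriv_eq.trans (extDeriv_pullback (hθ.differentiableAt he' hz) hg
    minSmoothness_two_le)
  have h3 : pullback (E := E) e (ofFun (extDeriv ((pullback (E := E) f θ).inChart e))) x =
      pullback (E := E) e (pullback (E := E) (e' ∘ f ∘ e.symm)
        (ofFun (extDeriv (θ.inChart e')))) x := by
    have h4 : extDeriv ((pullback (E := E) f θ).inChart e) (e x) =
        pullback (E := E) (e' ∘ f ∘ e.symm) (ofFun (extDeriv (θ.inChart e'))) (e x) := by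
      rw [h2, pullback, mfderiv_eq_fderiv]
      rfl
    exact congrArg (fun φ : E [⋀^Fin (p + 1)]→L[ℝ] V => φ.compContinuousLinearMap
      (mfderiv 𝓘(ℝ, E) 𝓘(ℝ, E) e x : E →L[ℝ] E)) h4
  rw [h3, ← pullback_comp_apply, ← pullback_comp_apply]
  · refine pullback_congr _ ?_
    filter_upwards [e.open_source.mem_nhds hx] with z hz
    simp [e.left_inv hz]
  · exact mdifferentiableAt_atlas he' hx'
  · exact hf.mdifferentiable (by simp) _
  · exact (hg.differentiableAt (by simp)).mdifferentiableAt
  · exact mdifferentiableAt_atlas he hx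

theorem extd_eq_pullback {θ : PreForm E M V p} (hθ : θ.IsSmooth) {e : OpenPartialHomeomorph M E}
    (he : e ∈ atlas E M) {x : M} (hx : x ∈ e.source) :
    θ.extd x = pullback (E := E) e (ofFun (extDeriv (θ.inChart e))) x := by
  have h := pullback_extDeriv_inChart contMDiff_id hθ (chart_mem_atlas E x) he
    (mem_chart_source E x) hx
  rw [pullback_id, pullback_id] at h
  exact h

/-- The exterior derivative commutes with pullbacks. -/
theorem extd_pullback {f : M → N} (hf : ContMDiff 𝓘(ℝ, E) 𝓘(ℝ, E') ∞ f)
    {θ : PreForm E' N V p} (hθ : θ.IsSmooth) :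
    (pullback (E := E) f θ).extd = pullback (E := E) f θ.extd :=
  funext fun x => pullback_extDeriv_inChart hf hθ (chart_mem_atlas E x)
    (chart_mem_atlas E' (f x)) (mem_chart_source E x) (mem_chart_source E' (f x))

/-- Valid on the whole target of every chart in the atlas, although `extd` changes chart from point
to point. This gives smoothness of `extd` and reduces `d² = 0` to normed spaces. -/
theorem inChart_extd {θ : PreForm E M V p} (hθ : θ.IsSmooth) {e : OpenPartialHomeomorph M E}
    (he : e ∈ atlas E M) {y : E} (hy : y ∈ e.target) :
    θ.extd.inChart e y = extDeriv (θ.inChart e) y := by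
  have h1 : θ.extd.inChart e y = pullback (E := E) e.symm
      (pullback (E := E) e (ofFun (extDeriv (θ.inChart e)))) y :=
    congrArg (fun φ : E [⋀^Fin (p + 1)]→L[ℝ] V => φ.compContinuousLinearMap
      (mfderiv 𝓘(ℝ, E) 𝓘(ℝ, E) e.symm y : E →L[ℝ] E))
      (extd_eq_pullback hθ he (e.map_target hy))
  rw [h1, ← pullback_comp_apply _ (mdifferentiableAt_atlas he (e.map_target hy))
    (mdifferentiableAt_atlas_symm he hy)]
  have h2 : (e ∘ e.symm : E → E) =ᶠ[𝓝 y] id := by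
    filter_upwards [e.open_target.mem_nhds hy] with z hz
    exact e.right_inv hz
  rw [pullback_congr _ h2, pullback_id]
  rfl

theorem IsSmooth.extd {θ : PreForm E M V p} (hθ : θ.IsSmooth) : θ.extd.IsSmooth := fun e he => by
  have h := (ContinuousAlternatingMap.alternatizeUncurryFinCLM ℝ E V
    (n := p)).contDiff.comp_contDiffOn ((hθ e he).fderiv_of_isOpen e.open_target (m := ∞) le_rfl)
  exact h.congr fun y hy => inChart_extd hθ he hy

theorem extd_extd {θ : PreForm E M V p} (hθ : θ.IsSmooth) : θ.extd.extd = 0 := by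
  funext x
  have hx := mem_chart_target E x
  have h1 : θ.extd.inChart (chartAt E x) =ᶠ[𝓝 (chartAt E x x)]
      extDeriv (θ.inChart (chartAt E x)) := by
    filter_upwards [(chartAt E x).open_target.mem_nhds hx] with y hy
    exact inChart_extd hθ (chart_mem_atlas E x) hy
  have h2 := extDeriv_extDeriv_apply ((hθ _ (chart_mem_atlas E x)).contDiffAt
    ((chartAt E x).open_target.mem_nhds hx))
    minSmoothness_two_le
  rw [PreForm.extd, h1.extDeriv_eq, h2]
  rfl

theorem extd_add {θ η : PreForm E M V p} (hθ : θ.IsSmooth) (hη : η.IsSmooth) :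
    (θ + η).extd = θ.extd + η.extd := by
  funext x
  have h := extDeriv_add (hθ.differentiableAt (chart_mem_atlas E x) (mem_chart_target E x))
    (hη.differentiableAt (chart_mem_atlas E x) (mem_chart_target E x))
  rw [PreForm.extd, inChart_add, h]
  rfl

theorem extd_smul (c : ℝ) (θ : PreForm E M V p) : (c • θ).extd = c • θ.extd := by
  funext x
  rw [PreForm.extd, inChart_smul, extDeriv_smul]
  rfl

theorem IsSmooth.neg {θ : PreForm E M V p} (hθ : θ.IsSmooth) : (-θ).IsSmooth := by
  rw [← neg_one_smul ℝ θ]; exact hθ.smul _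

theorem IsSmooth.sub {θ η : PreForm E M V p} (hθ : θ.IsSmooth) (hη : η.IsSmooth) :
    (θ - η).IsSmooth := by
  rw [sub_eq_add_neg]; exact hθ.add hη.neg

theorem extd_sub {θ η : PreForm E M V p} (hθ : θ.IsSmooth) (hη : η.IsSmooth) :
    (θ - η).extd = θ.extd - η.extd := by
  rw [sub_eq_add_neg, extd_add hθ hη.neg, ← neg_one_smul ℝ η, extd_smul, neg_one_smul,
    ← sub_eq_add_neg]

variable [FiniteDimensional ℝ V]

/-- Application of a linear map to the values of an alternating map, as a continuous linear
map. -/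
def mapValuesCLM (E : Type*) [NormedAddCommGroup E] [NormedSpace ℝ E] (L : V →ₗ[ℝ] W) (p : ℕ) :
    (E [⋀^Fin p]→L[ℝ] V) →L[ℝ] (E [⋀^Fin p]→L[ℝ] W) :=
  ContinuousLinearMap.compContinuousAlternatingMapCLM ℝ E V W (Fin p)
    L.toContinuousLinearMap

theorem inChart_mapValues (L : V →ₗ[ℝ] W) (θ : PreForm E M V p) (e : OpenPartialHomeomorph M E) :
    (θ.mapValues L).inChart e = mapValuesCLM E L p ∘ θ.inChart e := rfl

theorem IsSmooth.mapValues (L : V →ₗ[ℝ] W) {θ : PreForm E M V p} (hθ : θ.IsSmooth) :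
    (θ.mapValues L).IsSmooth := fun e he => by
  rw [inChart_mapValues]
  exact (mapValuesCLM E L p).contDiff.comp_contDiffOn (hθ e he)

theorem extd_mapValues (L : V →ₗ[ℝ] W) {θ : PreForm E M V p} (hθ : θ.IsSmooth) :
    (θ.mapValues L).extd = θ.extd.mapValues L := by
  funext x
  have h := hθ.differentiableAt (chart_mem_atlas E x) (mem_chart_target E x)
  -- A constant linear map commutes with `fderiv` by the chain rule and with the finite
  -- antisymmetrising sum by linearity.
  have h1 : extDeriv (mapValuesCLM E L p ∘ θ.inChart (chartAt E x)) (chartAt E x x) =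
      mapValuesCLM E L (p + 1) (extDeriv (θ.inChart (chartAt E x)) (chartAt E x x)) := by
    rw [extDeriv, fderiv_comp _ (mapValuesCLM E L p).differentiableAt h,
      (mapValuesCLM E L p).fderiv]
    ext v
    change _ = L (ContinuousAlternatingMap.alternatizeUncurryFin _ v)
    rw [ContinuousAlternatingMap.alternatizeUncurryFin_apply,
      ContinuousAlternatingMap.alternatizeUncurryFin_apply, map_sum]
    refine Finset.sum_congr rfl fun i _ => ?_
    rw [map_zsmul]
    rfl
  rw [PreForm.extd, inChart_mapValues, h1]
  rfl

variable [FiniteDimensional ℝ W]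

theorem IsSmooth.wedgeTo (B : V →ₗ[ℝ] W →ₗ[ℝ] U) {θ : PreForm E M V p} (hθ : θ.IsSmooth)
    {η : PreForm E M W q} (hη : η.IsSmooth) (h : p + q = n) : (θ.wedgeTo B η h).IsSmooth := by
  subst h
  intro e he
  refine ContDiffOn.congr (f := fun y => wedgeCLM E B p q (θ.inChart e y) (η.inChart e y)) ?_
    fun y _ => wedge_compContinuousLinearMap B _ _ _
  exact ((wedgeCLM E B p q).contDiff.comp_contDiffOn (hθ e he)).clm_apply (hη e he)

/-- The Leibniz rule. -/
theorem extd_wedgeTo (B : V →ₗ[ℝ] W →ₗ[ℝ] U) {θ : PreForm E M V p} (hθ : θ.IsSmooth)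
    {η : PreForm E M W q} (hη : η.IsSmooth) (h : p + q = n) (h₁ : p + 1 + q = n + 1)
    (h₂ : p + (q + 1) = n + 1) :
    (θ.wedgeTo B η h).extd = θ.extd.wedgeTo B η h₁ +
      (-1 : ℝ) ^ p • θ.wedgeTo B η.extd h₂ := by
  subst h
  funext x
  have hc := chart_mem_atlas E x
  have h1 : (θ.wedgeTo B η rfl).inChart (chartAt E x) = fun y =>
      GForms.wedge B (θ.inChart (chartAt E x) y) (η.inChart (chartAt E x) y) :=
    funext fun y => wedge_compContinuousLinearMap B _ _ _
  have h2 := extDeriv_wedge B (hθ.differentiableAt hc (mem_chart_target E x))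
    (hη.differentiableAt hc (mem_chart_target E x))
  have h3 := pullback_inChart θ hc (mem_chart_source E x)
  have h4 := pullback_inChart η hc (mem_chart_source E x)
  ext v
  rw [PreForm.extd, h1]
  refine (h2 fun i => mfderiv 𝓘(ℝ, E) 𝓘(ℝ, E) (chartAt E x) x (v i)).trans ?_
  rw [Pi.add_apply, ContinuousAlternatingMap.add_apply, Pi.smul_apply,
    ContinuousAlternatingMap.smul_apply]
  congr 1
  -- The undifferentiated factor is rewritten as the pullback of its own chart expression, so that
  -- both factors are pullbacks along the chart.
  · rw [PreForm.wedgeTo, castDeg_apply, PreForm.wedge, ← h4]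
    exact congrArg (fun φ : E [⋀^Fin (p + 1 + q)]→L[ℝ] U => φ (v ∘ Fin.cast h₁))
      (wedge_compContinuousLinearMap (T := E) (T' := E) B
      (extDeriv (θ.inChart (chartAt E x)) (chartAt E x x)) (η.inChart (chartAt E x) (chartAt E x x))
      (mfderiv 𝓘(ℝ, E) 𝓘(ℝ, E) (chartAt E x) x))
  · congr 1
    rw [PreForm.wedgeTo, castDeg_apply, PreForm.wedge, ← h3]
    exact congrArg (fun φ : E [⋀^Fin (p + (q + 1))]→L[ℝ] U => φ v)
      (wedge_compContinuousLinearMap (T := E) (T' := E) B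
      (θ.inChart (chartAt E x) (chartAt E x x)) (extDeriv (η.inChart (chartAt E x)) (chartAt E x x))
      (mfderiv 𝓘(ℝ, E) 𝓘(ℝ, E) (chartAt E x) x))

end Manifold

end PreForm

/-! ### Graded Jacobi identity -/

namespace PreForm

variable {E : Type*} [NormedAddCommGroup E] [NormedSpace ℝ E]
  {M : Type*} [TopologicalSpace M] [ChartedSpace E M]
  {V : Type*} [NormedAddCommGroup V] [NormedSpace ℝ V] [FiniteDimensional ℝ V] {k l i n : ℕ}

theorem wedgeTo_antisymm {B : V →ₗ[ℝ] V →ₗ[ℝ] V} (hB : ∀ x y, B x y = -B y x)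
    (θ : PreForm E M V k) (η : PreForm E M V l) (h : k + l = n) :
    θ.wedgeTo B η h = -((-1 : ℝ) ^ (k * l) • η.wedgeTo B θ ((Nat.add_comm l k).trans h)) := by
  have h1 : B.flip = -B := by
    ext x y
    exact hB y x
  rw [wedgeTo_comm, h1, wedgeTo_neg_bilin, smul_neg]

/-- The graded Jacobi identity for forms with values in a Lie algebra. -/
theorem wedgeTo_jacobi {B : V →ₗ[ℝ] V →ₗ[ℝ] V} (hB : ∀ x y, B x y = -B y x)
    (hJ : ∀ x y z, B (B x y) z = B x (B y z) - B y (B x z))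
    (θ : PreForm E M V k) (η : PreForm E M V l) (ζ : PreForm E M V i) {a b c : ℕ}
    (ha : k + l = a) (ha' : a + i = n) (hb : i + k = b) (hb' : b + l = n)
    (hc : l + i = c) (hc' : c + k = n) :
    (-1 : ℝ) ^ (k * i) • (θ.wedgeTo B η ha).wedgeTo B ζ ha' +
      (-1 : ℝ) ^ (l * i) • (ζ.wedgeTo B θ hb).wedgeTo B η hb' +
      (-1 : ℝ) ^ (k * l) • (η.wedgeTo B ζ hc).wedgeTo B θ hc' = 0 := by
  subst hb hc
  have hkb : k + i = i + k := Nat.add_comm k i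
  have hlb : l + (i + k) = n := (Nat.add_comm l (i + k)).trans hb'
  have hkc : k + (l + i) = n := (Nat.add_comm k (l + i)).trans hc'
  have h1 := wedgeTo_action hJ θ η ζ ha ha' rfl hkc hkb hlb
  -- Antisymmetry is used for the outer and for the inner bracket; the two minus signs cancel and
  -- the two exponents add.
  have h2 : (ζ.wedgeTo B θ rfl).wedgeTo B η hb' =
      (-1 : ℝ) ^ ((i + k) * l + i * k) • η.wedgeTo B (θ.wedgeTo B ζ hkb) hlb := by
    rw [wedgeTo_antisymm hB _ η, wedgeTo_antisymm hB ζ θ, ← neg_one_smul ℝ ((-1 : ℝ) ^ (i * k) • _),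
      wedgeTo_smul_right, wedgeTo_smul_right, pow_add]
    module
  have h3 : (η.wedgeTo B ζ rfl).wedgeTo B θ hc' =
      -((-1 : ℝ) ^ ((l + i) * k) • θ.wedgeTo B (η.wedgeTo B ζ rfl) hkc) :=
    wedgeTo_antisymm hB _ θ hc'
  rw [h1, h2, h3]
  simp only [add_mul, pow_add, Nat.mul_comm i l, Nat.mul_comm i k, Nat.mul_comm l k]
  -- After expansion all signs are products of three parities, and in each of the eight cases the
  -- identity is linear in the nested products.
  rcases neg_one_pow_eq_or ℝ (k * l) with e1 | e1 <;>
    rcases neg_one_pow_eq_or ℝ (k * i) with e2 | e2 <;>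
    rcases neg_one_pow_eq_or ℝ (l * i) with e3 | e3 <;>
    rw [e1, e2, e3] <;> module

end PreForm

/-! ### Forms on the nerve of a Lie groupoid -/

section Nerve

variable {E₀ P₀ E₁ P₁ : Type*} [NormedAddCommGroup E₀] [NormedSpace ℝ E₀]
  [TopologicalSpace P₀] [ChartedSpace E₀ P₀] [IsManifold 𝓘(ℝ, E₀) ∞ P₀]
  [NormedAddCommGroup E₁] [NormedSpace ℝ E₁]
  [TopologicalSpace P₁] [ChartedSpace E₁ P₁] [IsManifold 𝓘(ℝ, E₁) ∞ P₁]
  (G : LieGroupoid E₀ P₀ E₁ P₁)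
  {V : Type*} [NormedAddCommGroup V] [NormedSpace ℝ V] {p q : ℕ}

theorem LieGroupoid.contMDiff_s : ContMDiff 𝓘(ℝ, E₁) 𝓘(ℝ, E₀) ∞ G.s :=
  G.graph.submersion_s.contMDiff

theorem LieGroupoid.contMDiff_t : ContMDiff 𝓘(ℝ, E₁) 𝓘(ℝ, E₀) ∞ G.t :=
  G.graph.submersion_t.contMDiff

/-- Locally the projection is a chart followed by the projection read in that chart, which is smooth
by the construction of the charts of the fibre product. -/
theorem SmoothGraph.contMDiff_fst (G : SmoothGraph E₀ P₀ E₁ P₁) :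
    ContMDiff 𝓘(ℝ, G.PairsModel) 𝓘(ℝ, E₁) ∞ (FiberProduct.fst : G.Pairs → P₁) := by
  intro r
  let c := chartAt G.PairsModel r
  have h1 := FiberProduct.contMDiffOn_chart_symm_fst (EN := E₁)
    G.submersion_s.isSubmersionOfComplement_complement G.submersion_t.contMDiff r
  have h2 : ContMDiffOn 𝓘(ℝ, G.PairsModel) 𝓘(ℝ, G.PairsModel) ∞ c c.source := contMDiffOn_chart
  have h3 := h1.comp h2 fun z hz => c.map_source hz
  refine ((h3.congr fun z hz => ?_).contMDiffAt
    (c.open_source.mem_nhds (mem_chart_source _ r)))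
  exact (congrArg FiberProduct.fst (c.left_inv hz)).symm

theorem SmoothGraph.contMDiff_snd (G : SmoothGraph E₀ P₀ E₁ P₁) :
    ContMDiff 𝓘(ℝ, G.PairsModel) 𝓘(ℝ, E₁) ∞ (FiberProduct.snd : G.Pairs → P₁) := by
  intro r
  let c := chartAt G.PairsModel r
  have h1 := FiberProduct.contMDiffOn_chart_symm_snd (EN := E₁)
    G.submersion_s.isSubmersionOfComplement_complement G.submersion_t.contMDiff.continuous r
  have h2 : ContMDiffOn 𝓘(ℝ, G.PairsModel) 𝓘(ℝ, G.PairsModel) ∞ c c.source := contMDiffOn_chart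
  have h3 := h1.comp h2 fun z hz => c.map_source hz
  refine ((h3.congr fun z hz => ?_).contMDiffAt
    (c.open_source.mem_nhds (mem_chart_source _ r)))
  exact (congrArg FiberProduct.snd (c.left_inv hz)).symm

theorem LieGroupoid.pullback_comp_s (θ : PreForm E₀ P₀ V p) :
    (θ.pullback (E := E₁) G.s).pullback (E := G.graph.PairsModel) G.comp =
      (θ.pullback (E := E₁) G.s).pullback FiberProduct.snd := by
  rw [← PreForm.pullback_comp θ G.contMDiff_s G.smooth_comp,
    ← PreForm.pullback_comp θ G.contMDiff_s G.graph.contMDiff_snd]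
  exact congrArg (fun f => θ.pullback f) (funext G.s_comp)

theorem LieGroupoid.pullback_comp_t (θ : PreForm E₀ P₀ V p) :
    (θ.pullback (E := E₁) G.t).pullback (E := G.graph.PairsModel) G.comp =
      (θ.pullback (E := E₁) G.t).pullback FiberProduct.fst := by
  rw [← PreForm.pullback_comp θ G.contMDiff_t G.smooth_comp,
    ← PreForm.pullback_comp θ G.contMDiff_t G.graph.contMDiff_fst]
  exact congrArg (fun f => θ.pullback f) (funext G.t_comp)

theorem LieGroupoid.pullback_fst_s (θ : PreForm E₀ P₀ V p) :
    (θ.pullback (E := E₁) G.s).pullback (E := G.graph.PairsModel) (M := G.graph.Pairs)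
      FiberProduct.fst = (θ.pullback (E := E₁) G.t).pullback FiberProduct.snd := by
  rw [← PreForm.pullback_comp θ G.contMDiff_s G.graph.contMDiff_fst,
    ← PreForm.pullback_comp θ G.contMDiff_t G.graph.contMDiff_snd]
  exact congrArg (fun f => θ.pullback f) (funext fun r : G.graph.Pairs => r.w)

/-- Of the six pullbacks, the three simplicial relations leave three distinct ones, each occurring
with both signs. -/
theorem LieGroupoid.delta₁_delta₀ (θ : PreForm E₀ P₀ V p) : G.delta₁ (G.delta₀ θ) = 0 := by
  have h1 := G.pullback_comp_s θ
  have h2 := G.pullback_comp_t θ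
  have h3 := G.pullback_fst_s θ
  simp only [delta₁, delta₀, PreForm.pullback_sub]
  rw [h1, h2, h3]
  abel

theorem LieGroupoid.delta₀_extd {θ : PreForm E₀ P₀ V p} (hθ : θ.IsSmooth) :
    G.delta₀ θ.extd = (G.delta₀ θ).extd := by
  rw [delta₀, delta₀, PreForm.extd_sub (hθ.pullback G.contMDiff_t) (hθ.pullback G.contMDiff_s),
    PreForm.extd_pullback G.contMDiff_t hθ, PreForm.extd_pullback G.contMDiff_s hθ]

theorem LieGroupoid.delta₁_extd {θ : PreForm E₁ P₁ V p} (hθ : θ.IsSmooth) :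
    G.delta₁ θ.extd = (G.delta₁ θ).extd := by
  have h1 := hθ.pullback G.graph.contMDiff_fst
  have h2 := hθ.pullback G.smooth_comp
  have h3 := hθ.pullback G.graph.contMDiff_snd
  rw [delta₁, delta₁, PreForm.extd_add (h1.sub h2) h3, PreForm.extd_sub h1 h2,
    PreForm.extd_pullback G.graph.contMDiff_fst hθ, PreForm.extd_pullback G.smooth_comp hθ,
    PreForm.extd_pullback G.graph.contMDiff_snd hθ]

theorem LieGroupoid.delta₀_sub (θ η : PreForm E₀ P₀ V p) :
    G.delta₀ (θ - η) = G.delta₀ θ - G.delta₀ η := by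
  simp only [delta₀, PreForm.pullback_sub]; abel

theorem LieGroupoid.delta₀_add (θ η : PreForm E₀ P₀ V p) :
    G.delta₀ (θ + η) = G.delta₀ θ + G.delta₀ η := by
  simp only [delta₀, PreForm.pullback_add]; abel

theorem LieGroupoid.delta₀_smul (c : ℝ) (θ : PreForm E₀ P₀ V p) :
    G.delta₀ (c • θ) = c • G.delta₀ θ := by
  simp only [delta₀, PreForm.pullback_smul, smul_sub]

theorem LieGroupoid.delta₁_sub (θ η : PreForm E₁ P₁ V p) :
    G.delta₁ (θ - η) = G.delta₁ θ - G.delta₁ η := by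
  simp only [delta₁, PreForm.pullback_sub]; abel

theorem LieGroupoid.delta₁_smul (c : ℝ) (θ : PreForm E₁ P₁ V p) :
    G.delta₁ (c • θ) = c • G.delta₁ θ := by
  simp only [delta₁, PreForm.pullback_smul, smul_sub, smul_add]

theorem LieGroupoid.delta₀_mapValues [FiniteDimensional ℝ V] {W : Type*} [NormedAddCommGroup W]
    [NormedSpace ℝ W] (L : V →ₗ[ℝ] W) (θ : PreForm E₀ P₀ V p) :
    G.delta₀ (θ.mapValues L) = (G.delta₀ θ).mapValues L := by
  simp only [delta₀, PreForm.mapValues_sub]; rfl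

theorem LieGroupoid.isSmooth_delta₀ {θ : PreForm E₀ P₀ V p} (hθ : θ.IsSmooth) :
    (G.delta₀ θ).IsSmooth :=
  (hθ.pullback G.contMDiff_t).sub (hθ.pullback G.contMDiff_s)

end Nerve

/-! ### Bilinear maps of a Lie 2-algebra -/

section Bilinear

variable {𝔥 𝔤 : Type*} [LieRing 𝔥] [LieAlgebra ℝ 𝔥] [LieRing 𝔤] [LieAlgebra ℝ 𝔤]
  (γ : Lie2Algebra 𝔥 𝔤)

theorem lieBracket_antisymm (x y : 𝔤) : lieBracket 𝔤 x y = -lieBracket 𝔤 y x :=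
  (lie_skew x y).symm

theorem lieBracket_jacobi (x y z : 𝔤) : lieBracket 𝔤 (lieBracket 𝔤 x y) z =
    lieBracket 𝔤 x (lieBracket 𝔤 y z) - lieBracket 𝔤 y (lieBracket 𝔤 x z) :=
  lie_lie x y z

theorem Lie2Algebra.action_lie (x y : 𝔤) (z : 𝔥) : γ.action (lieBracket 𝔤 x y) z =
    γ.action x (γ.action y z) - γ.action y (γ.action x z) := by
  change γ.α ⁅x, y⁆ z = γ.α x (γ.α y z) - γ.α y (γ.α x z)
  rw [LieHom.map_lie, LieDerivation.lie_apply]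

/-- The Peiffer identity as an equality of bilinear maps, the form in which it applies to wedge
products. -/
theorem Lie2Algebra.action_comp_t : γ.action ∘ₗ (γ.t : 𝔥 →ₗ[ℝ] 𝔤) = lieBracket 𝔥 := by
  ext x y
  exact γ.α_t x y

theorem Lie2Algebra.action_compr₂_t : γ.action.compr₂ (γ.t : 𝔥 →ₗ[ℝ] 𝔤) =
    (lieBracket 𝔤).compl₂ (γ.t : 𝔥 →ₗ[ℝ] 𝔤) := by
  ext x y
  exact γ.t_α x y

theorem Lie2Algebra.lieBracket_compr₂_t : (lieBracket 𝔥).compr₂ (γ.t : 𝔥 →ₗ[ℝ] 𝔤) =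
    (lieBracket 𝔤 ∘ₗ (γ.t : 𝔥 →ₗ[ℝ] 𝔤)).compl₂ (γ.t : 𝔥 →ₗ[ℝ] 𝔤) := by
  ext x y
  exact LieHom.map_lie γ.t x y

/-- The bracket of the semidirect product of `𝔤` and `𝔥`. -/
def Lie2Algebra.semidirect : 𝔤 × 𝔥 →ₗ[ℝ] 𝔤 × 𝔥 →ₗ[ℝ] 𝔤 × 𝔥 :=
  LinearMap.mk₂ ℝ (fun x y => (⁅x.1, y.1⁆, ⁅x.2, y.2⁆ + γ.α x.1 y.2 - γ.α y.1 x.2))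
    (fun x x' y => by ext <;> simp; abel) (fun c x y => by ext <;> simp [smul_add, smul_sub])
    (fun x y y' => by ext <;> simp; abel) (fun c x y => by ext <;> simp [smul_add, smul_sub])

theorem Lie2Algebra.semidirect_antisymm (x y : 𝔤 × 𝔥) :
    γ.semidirect x y = -γ.semidirect y x := by
  refine Prod.ext (lie_skew x.1 y.1).symm ?_
  change ⁅x.2, y.2⁆ + γ.α x.1 y.2 - γ.α y.1 x.2 = -(⁅y.2, x.2⁆ + γ.α y.1 x.2 - γ.α x.1 y.2)
  rw [← lie_skew]
  abel

/-- The `𝔥`-part combines the Jacobi identity of `𝔥`, the derivation property of each `α_* X`, and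
the compatibility of `α_*` with brackets. -/
theorem Lie2Algebra.semidirect_jacobi (x y z : 𝔤 × 𝔥) :
    γ.semidirect (γ.semidirect x y) z =
      γ.semidirect x (γ.semidirect y z) - γ.semidirect y (γ.semidirect x z) := by
  refine Prod.ext (lie_lie x.1 y.1 z.1) ?_
  change ⁅⁅x.2, y.2⁆ + γ.α x.1 y.2 - γ.α y.1 x.2, z.2⁆ + γ.α ⁅x.1, y.1⁆ z.2 -
      γ.α z.1 (⁅x.2, y.2⁆ + γ.α x.1 y.2 - γ.α y.1 x.2) =
    ⁅x.2, ⁅y.2, z.2⁆ + γ.α y.1 z.2 - γ.α z.1 y.2⁆ +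
        γ.α x.1 (⁅y.2, z.2⁆ + γ.α y.1 z.2 - γ.α z.1 y.2) - γ.α ⁅y.1, z.1⁆ x.2 -
      (⁅y.2, ⁅x.2, z.2⁆ + γ.α x.1 z.2 - γ.α z.1 x.2⁆ +
        γ.α y.1 (⁅x.2, z.2⁆ + γ.α x.1 z.2 - γ.α z.1 x.2) - γ.α ⁅x.1, z.1⁆ y.2)
  simp only [LieHom.map_lie, LieDerivation.lie_apply, map_add, map_sub, add_lie, sub_lie, lie_add,
    lie_sub, LieDerivation.apply_lie_eq_add, lie_lie x.2 y.2 z.2]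
  rw [← lie_skew (γ.α z.1 x.2) y.2, ← lie_skew (γ.α y.1 x.2) z.2, ← lie_skew (γ.α x.1 y.2) z.2]
  abel

end Bilinear

/-! ### Closure of `Omega` under `D` and the bracket, linearity, and `D² = 0`. -/

section Brackets

variable {E₀ P₀ E₁ P₁ 𝔥 𝔤 : Type*} [NormedAddCommGroup E₀] [NormedSpace ℝ E₀]
  [TopologicalSpace P₀] [ChartedSpace E₀ P₀] [IsManifold 𝓘(ℝ, E₀) ∞ P₀]
  [NormedAddCommGroup E₁] [NormedSpace ℝ E₁]
  [TopologicalSpace P₁] [ChartedSpace E₁ P₁] [IsManifold 𝓘(ℝ, E₁) ∞ P₁]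
  [NormedLieRing 𝔥] [NormedLieAlgebra 𝔥] [FiniteDimensional ℝ 𝔥]
  [NormedLieRing 𝔤] [NormedLieAlgebra 𝔤] [FiniteDimensional ℝ 𝔤]
  {G : LieGroupoid E₀ P₀ E₁ P₁} {γ : Lie2Algebra 𝔥 𝔤} {k l i p n : ℕ}

open PreForm

section Values

variable {E M : Type*} [NormedAddCommGroup E] [NormedSpace ℝ E] [TopologicalSpace M]
  [ChartedSpace E M]

theorem wedgeTo_t_action (θ : PreForm E M 𝔥 k) (η : PreForm E M 𝔥 l) (h : k + l = n) :
    (θ.mapValues (γ.t : 𝔥 →ₗ[ℝ] 𝔤)).wedgeTo γ.action η h = θ.wedgeTo (lieBracket 𝔥) η h := by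
  rw [wedgeTo_mapValues_left, γ.action_comp_t]

theorem t_wedgeTo_action (θ : PreForm E M 𝔤 k) (η : PreForm E M 𝔥 l) (h : k + l = n) :
    (θ.wedgeTo γ.action η h).mapValues (γ.t : 𝔥 →ₗ[ℝ] 𝔤) =
      θ.wedgeTo (lieBracket 𝔤) (η.mapValues (γ.t : 𝔥 →ₗ[ℝ] 𝔤)) h := by
  rw [mapValues_wedgeTo, γ.action_compr₂_t, wedgeTo_mapValues_right]

theorem t_wedgeTo_lieBracket (θ : PreForm E M 𝔥 k) (η : PreForm E M 𝔥 l) (h : k + l = n) :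
    (θ.wedgeTo (lieBracket 𝔥) η h).mapValues (γ.t : 𝔥 →ₗ[ℝ] 𝔤) =
      (θ.mapValues (γ.t : 𝔥 →ₗ[ℝ] 𝔤)).wedgeTo (lieBracket 𝔤)
        (η.mapValues (γ.t : 𝔥 →ₗ[ℝ] 𝔤)) h := by
  rw [mapValues_wedgeTo, γ.lieBracket_compr₂_t, wedgeTo_mapValues_right, wedgeTo_mapValues_left]
  rfl

end Values

theorem preBracket_fst (Ψ : PreOmega G γ k) (Φ : PreOmega G γ l) :
    (preBracket Ψ Φ).1 = Ψ.1.wedgeTo (lieBracket 𝔤) Φ.1 rfl := rfl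

theorem preBracket_snd_fst (Ψ : PreOmega G γ k) (Φ : PreOmega G γ l) :
    (preBracket Ψ Φ).2.1 = Ψ.2.1.wedgeTo (lieBracket 𝔥) Φ.2.1 rfl +
      (Ψ.1.pullback G.s).wedgeTo γ.action Φ.2.1 rfl -
      (-1 : ℝ) ^ (k * l) • (Φ.1.pullback G.s).wedgeTo γ.action Ψ.2.1 (Nat.add_comm l k) := rfl

theorem preBracket_snd_snd (Ψ : PreOmega G γ k) (Φ : PreOmega G γ l) :
    (preBracket Ψ Φ).2.2 = Ψ.1.wedgeTo γ.action Φ.2.2 (Nat.add_assoc k l 1).symm -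
      (-1 : ℝ) ^ (k * l) • Φ.1.wedgeTo γ.action Ψ.2.2 (by omega) := rfl

theorem pullback_t_eq {Ψ : PreOmega G γ p} (hΨ : Ψ ∈ Omega G γ p) :
    Ψ.1.pullback (E := E₁) G.t = Ψ.1.pullback G.s + Ψ.2.1.mapValues (γ.t : 𝔥 →ₗ[ℝ] 𝔤) := by
  rw [← hΨ.2.2.2.1, LieGroupoid.delta₀]
  abel

theorem pullback_comp_eq {Ψ : PreOmega G γ p} (hΨ : Ψ ∈ Omega G γ p) :
    Ψ.2.1.pullback (E := G.graph.PairsModel) G.comp =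
      Ψ.2.1.pullback FiberProduct.fst + Ψ.2.1.pullback FiberProduct.snd := by
  have h := hΨ.2.2.2.2
  rw [LieGroupoid.delta₁, sub_add_eq_add_sub, sub_eq_zero] at h
  exact h.symm

/-- `Δ` commutes with `d` and with `t_*`, so the correction terms match in the first condition; in
the second they vanish by `Δ² = 0`. -/
theorem preD_mem {Ψ : PreOmega G γ p} (hΨ : Ψ ∈ Omega G γ p) : preD Ψ ∈ Omega G γ (p + 1) := by
  obtain ⟨h1, h2, h3, h4, h5⟩ := hΨ
  refine ⟨h1.extd.sub ((h3.mapValues _).smul _), h2.extd.sub ((G.isSmooth_delta₀ h3).smul _),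
    h3.extd, ?_, ?_⟩
  · simp only [preD]
    rw [G.delta₀_sub, G.delta₀_extd h1, h4, extd_mapValues _ h2, mapValues_sub, G.delta₀_smul,
      mapValues_smul, G.delta₀_mapValues]
  · simp only [preD]
    -- What remains is `d 0 = 0`, obtained by writing zero as `0 • 0` and using homogeneity of `d`.
    rw [G.delta₁_sub, G.delta₁_extd h2, h5, G.delta₁_smul, G.delta₁_delta₀, smul_zero, sub_zero,
      ← zero_smul ℝ (0 : PreForm G.graph.PairsModel G.graph.Pairs 𝔥 p), extd_smul, zero_smul]

theorem preBracket_mem {Ψ : PreOmega G γ k} {Φ : PreOmega G γ l} (hΨ : Ψ ∈ Omega G γ k)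
    (hΦ : Φ ∈ Omega G γ l) : preBracket Ψ Φ ∈ Omega G γ (k + l) := by
  have ht := pullback_t_eq hΨ
  have ht' := pullback_t_eq hΦ
  have hc := pullback_comp_eq hΨ
  have hc' := pullback_comp_eq hΦ
  obtain ⟨h1, h2, h3, -, -⟩ := hΨ
  obtain ⟨k1, k2, k3, -, -⟩ := hΦ
  have hs := h1.pullback G.contMDiff_s
  have hs' := k1.pullback G.contMDiff_s
  refine ⟨h1.wedgeTo _ k1 rfl, ((h2.wedgeTo _ k2 rfl).add (hs.wedgeTo _ k2 rfl)).sub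
    ((hs'.wedgeTo _ h2 _).smul _), (h1.wedgeTo _ k3 (Nat.add_assoc k l 1).symm).sub
      ((k1.wedgeTo _ h3 _).smul _), ?_, ?_⟩
  -- With `t^* = s^* + t_*` on the a-parts, `Δ[Ψᵃ ∧ Φᵃ]` consists of the two mixed brackets and the
  -- bracket of the `t_*`-parts. These are the `t_*`-images of the three terms of the b-component.
  · rw [preBracket_fst, preBracket_snd_fst, LieGroupoid.delta₀, pullback_wedgeTo,
      pullback_wedgeTo, ht, ht']
    simp only [mapValues_add, mapValues_sub, mapValues_smul, t_wedgeTo_action,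
      t_wedgeTo_lieBracket, wedgeTo_add_left, wedgeTo_add_right]
    rw [wedgeTo_antisymm lieBracket_antisymm (Φ.1.pullback G.s), Nat.mul_comm l k]
    rcases neg_one_pow_eq_or ℝ (k * l) with e1 | e1 <;> rw [e1] <;> module
  · rw [preBracket_snd_fst, LieGroupoid.delta₁]
    -- Moving `pr₁^* s^*` to `pr₂^* s^*` costs a term `t_* pr₂^*Ψᵇ`, which acts as a bracket by the
    -- Peiffer identity. These brackets cancel the cross terms in `c^*[Ψᵇ ∧ Φᵇ]`.
    have hf : (Ψ.1.pullback (E := E₁) G.s).pullback (E := G.graph.PairsModel) (M := G.graph.Pairs)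
        FiberProduct.fst = (Ψ.1.pullback (E := E₁) G.s).pullback FiberProduct.snd +
          (Ψ.2.1.pullback FiberProduct.snd).mapValues (γ.t : 𝔥 →ₗ[ℝ] 𝔤) := by
      rw [G.pullback_fst_s, ht]; rfl
    have hf' : (Φ.1.pullback (E := E₁) G.s).pullback (E := G.graph.PairsModel)
        (M := G.graph.Pairs) FiberProduct.fst =
          (Φ.1.pullback (E := E₁) G.s).pullback FiberProduct.snd +
          (Φ.2.1.pullback FiberProduct.snd).mapValues (γ.t : 𝔥 →ₗ[ℝ] 𝔤) := by
      rw [G.pullback_fst_s, ht']; rfl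
    simp only [pullback_add, PreForm.pullback_sub, pullback_smul, pullback_wedgeTo,
      G.pullback_comp_s, hf, hf', hc, hc', wedgeTo_add_left, wedgeTo_add_right, wedgeTo_t_action]
    rw [wedgeTo_antisymm lieBracket_antisymm (Φ.2.1.pullback FiberProduct.snd), Nat.mul_comm l k]
    rcases neg_one_pow_eq_or ℝ (k * l) with e1 | e1 <;> rw [e1] <;> module

theorem preD_add {Ψ Φ : PreOmega G γ p} (hΨ : Ψ ∈ Omega G γ p) (hΦ : Φ ∈ Omega G γ p) :
    preD (Ψ + Φ) = preD Ψ + preD Φ := by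
  refine Prod.ext ?_ (Prod.ext ?_ ?_)
  · simp only [preD, Prod.fst_add, Prod.snd_add, extd_add hΨ.1 hΦ.1, mapValues_add]
    module
  · simp only [preD, Prod.fst_add, Prod.snd_add, extd_add hΨ.2.1 hΦ.2.1, G.delta₀_add]
    module
  · exact extd_add hΨ.2.2.1 hΦ.2.2.1

theorem preD_smul (c : ℝ) (Ψ : PreOmega G γ p) : preD (c • Ψ) = c • preD Ψ := by
  refine Prod.ext ?_ (Prod.ext ?_ ?_)
  · simp only [preD, Prod.smul_fst, Prod.smul_snd, extd_smul, mapValues_smul]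
    module
  · simp only [preD, Prod.smul_fst, Prod.smul_snd, extd_smul, G.delta₀_smul]
    module
  · exact extd_smul c Ψ.2.2

/-- Besides `d² = 0`, the two correction terms cancel because the sign `(-1)^p` changes with the
degree. -/
theorem preD_preD {Ψ : PreOmega G γ p} (hΨ : Ψ ∈ Omega G γ p) : preD (preD Ψ) = 0 := by
  obtain ⟨h1, h2, h3, -, -⟩ := hΨ
  refine Prod.ext ?_ (Prod.ext ?_ ?_)
  · simp only [preD]
    rw [extd_sub h1.extd ((h3.mapValues _).smul _), extd_extd h1, extd_smul, extd_mapValues _ h3,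
      pow_succ]
    simp
  · simp only [preD]
    rw [extd_sub h2.extd ((G.isSmooth_delta₀ h3).smul _), extd_extd h2, extd_smul,
      G.delta₀_extd h3, pow_succ]
    simp
  · exact extd_extd h3

theorem preBracket_add_left (Ψ Ψ' : PreOmega G γ k) (Φ : PreOmega G γ l) :
    preBracket (Ψ + Ψ') Φ = preBracket Ψ Φ + preBracket Ψ' Φ := by
  refine Prod.ext ?_ (Prod.ext ?_ ?_) <;>
    simp only [preBracket_fst, preBracket_snd_fst, preBracket_snd_snd, Prod.fst_add, Prod.snd_add,
      pullback_add, wedgeTo_add_left, wedgeTo_add_right] <;> module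

theorem preBracket_add_right (Ψ : PreOmega G γ k) (Φ Φ' : PreOmega G γ l) :
    preBracket Ψ (Φ + Φ') = preBracket Ψ Φ + preBracket Ψ Φ' := by
  refine Prod.ext ?_ (Prod.ext ?_ ?_) <;>
    simp only [preBracket_fst, preBracket_snd_fst, preBracket_snd_snd, Prod.fst_add, Prod.snd_add,
      pullback_add, wedgeTo_add_left, wedgeTo_add_right] <;> module

theorem preBracket_smul_left (c : ℝ) (Ψ : PreOmega G γ k) (Φ : PreOmega G γ l) :
    preBracket (c • Ψ) Φ = c • preBracket Ψ Φ := by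
  refine Prod.ext ?_ (Prod.ext ?_ ?_) <;>
    simp only [preBracket_fst, preBracket_snd_fst, preBracket_snd_snd, Prod.smul_fst,
      Prod.smul_snd, pullback_smul, wedgeTo_smul_left, wedgeTo_smul_right] <;> module

theorem preBracket_smul_right (c : ℝ) (Ψ : PreOmega G γ k) (Φ : PreOmega G γ l) :
    preBracket Ψ (c • Φ) = c • preBracket Ψ Φ := by
  refine Prod.ext ?_ (Prod.ext ?_ ?_) <;>
    simp only [preBracket_fst, preBracket_snd_fst, preBracket_snd_snd, Prod.smul_fst,
      Prod.smul_snd, pullback_smul, wedgeTo_smul_left, wedgeTo_smul_right] <;> module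

end Brackets

/-! ### The differential graded Lie algebra of forms -/

section DGLA

variable {E₀ P₀ E₁ P₁ 𝔥 𝔤 : Type*} [NormedAddCommGroup E₀] [NormedSpace ℝ E₀]
  [TopologicalSpace P₀] [ChartedSpace E₀ P₀] [IsManifold 𝓘(ℝ, E₀) ∞ P₀]
  [NormedAddCommGroup E₁] [NormedSpace ℝ E₁]
  [TopologicalSpace P₁] [ChartedSpace E₁ P₁] [IsManifold 𝓘(ℝ, E₁) ∞ P₁]
  [NormedLieRing 𝔥] [NormedLieAlgebra 𝔥] [FiniteDimensional ℝ 𝔥]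
  [NormedLieRing 𝔤] [NormedLieAlgebra 𝔤] [FiniteDimensional ℝ 𝔤]
  {G : LieGroupoid E₀ P₀ E₁ P₁} {γ : Lie2Algebra 𝔥 𝔤} {k l i p q : ℕ}

open PreForm

theorem coe_castDeg_omega (h : p = q) (Ψ : Omega G γ p) :
    ((castDeg (fun p => Omega G γ p) h Ψ : Omega G γ q) : PreOmega G γ q) =
      castDeg (PreOmega G γ) h Ψ := by
  subst h; rfl

theorem castDeg_preOmega (h : p = q) (Ψ : PreOmega G γ p) :
    castDeg (PreOmega G γ) h Ψ = (castDeg (PreForm E₀ P₀ 𝔤) h Ψ.1,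
      castDeg (PreForm E₁ P₁ 𝔥) h Ψ.2.1,
      castDeg (PreForm E₀ P₀ 𝔥) (congrArg (· + 1) h) Ψ.2.2) := by
  subst h; rfl

theorem preBracket_antisymm (Ψ : PreOmega G γ k) (Φ : PreOmega G γ l) :
    castDeg (PreOmega G γ) (Nat.add_comm l k) (preBracket Φ Ψ) =
      -((-1 : ℝ) ^ (k * l) • preBracket Ψ Φ) := by
  rw [castDeg_preOmega]
  refine Prod.ext ?_ (Prod.ext ?_ ?_)
  · simp only [preBracket_fst, castDeg_wedgeTo, Prod.fst_neg, Prod.smul_fst]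
    rw [wedgeTo_antisymm lieBracket_antisymm Φ.1, Nat.mul_comm l k]
  · simp only [preBracket_snd_fst, castDeg_wedgeTo, castDeg_add, castDeg_sub, castDeg_smul,
      Prod.fst_neg, Prod.smul_fst, Prod.snd_neg, Prod.smul_snd]
    -- Only the bracket in `𝔥` needs antisymmetry; the two action terms are exchanged with each
    -- other.
    rw [wedgeTo_antisymm lieBracket_antisymm Φ.2.1, Nat.mul_comm l k]
    rcases neg_one_pow_eq_or ℝ (k * l) with e | e <;> rw [e] <;> module
  · simp only [preBracket_snd_snd, castDeg_wedgeTo, castDeg_sub, castDeg_smul,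
      Prod.smul_snd, Prod.snd_neg]
    rw [Nat.mul_comm l k]
    rcases neg_one_pow_eq_or ℝ (k * l) with e | e <;> rw [e] <;> module

/-- The form `(s^* Ψᵃ, Ψᵇ)` with values in the semidirect product of `𝔤` and `𝔥`. -/
def pairForm (Ψ : PreOmega G γ k) : PreForm E₁ P₁ (𝔤 × 𝔥) k :=
  (Ψ.1.pullback G.s).mapValues (LinearMap.inl ℝ 𝔤 𝔥) + Ψ.2.1.mapValues (LinearMap.inr ℝ 𝔤 𝔥)

theorem mapValues_snd_pairForm (Ψ : PreOmega G γ k) :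
    (pairForm Ψ).mapValues (LinearMap.snd ℝ 𝔤 𝔥) = Ψ.2.1 := by
  funext x
  ext v
  exact zero_add _

/-- The four blocks of the semidirect bracket reproduce the terms of the a- and b-components. The
block with `𝔥` first and `𝔤` second is minus the flipped action, and `wedgeTo_comm` supplies its
sign `(-1)^(kl)`. -/
theorem pairForm_preBracket (Ψ : PreOmega G γ k) (Φ : PreOmega G γ l) :
    pairForm (preBracket Ψ Φ) = (pairForm Ψ).wedgeTo γ.semidirect (pairForm Φ) rfl := by
  have h1 : γ.semidirect.compl₂ (LinearMap.inl ℝ 𝔤 𝔥) ∘ₗ LinearMap.inl ℝ 𝔤 𝔥 =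
      (lieBracket 𝔤).compr₂ (LinearMap.inl ℝ 𝔤 𝔥) := by
    ext x y <;> simp [Lie2Algebra.semidirect, lieBracket]
  have h2 : γ.semidirect.compl₂ (LinearMap.inr ℝ 𝔤 𝔥) ∘ₗ LinearMap.inr ℝ 𝔤 𝔥 =
      (lieBracket 𝔥).compr₂ (LinearMap.inr ℝ 𝔤 𝔥) := by
    ext x y <;> simp [Lie2Algebra.semidirect, lieBracket]
  have h3 : γ.semidirect.compl₂ (LinearMap.inr ℝ 𝔤 𝔥) ∘ₗ LinearMap.inl ℝ 𝔤 𝔥 =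
      γ.action.compr₂ (LinearMap.inr ℝ 𝔤 𝔥) := by
    ext x y <;> simp [Lie2Algebra.semidirect, Lie2Algebra.action]
  have h4 : γ.semidirect.compl₂ (LinearMap.inl ℝ 𝔤 𝔥) ∘ₗ LinearMap.inr ℝ 𝔤 𝔥 =
      -(γ.action.compr₂ (LinearMap.inr ℝ 𝔤 𝔥)).flip := by
    ext x y <;> simp [Lie2Algebra.semidirect, Lie2Algebra.action]
  simp only [pairForm, preBracket_fst, preBracket_snd_fst, wedgeTo_add_left, wedgeTo_add_right,
    wedgeTo_mapValues_left, wedgeTo_mapValues_right, mapValues_add, mapValues_sub, mapValues_smul,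
    mapValues_wedgeTo, pullback_wedgeTo, h1, h2, h3, h4, wedgeTo_neg_bilin]
  rw [wedgeTo_comm _ (Φ.1.pullback G.s), smul_smul, Nat.mul_comm l k, ← mul_pow]
  simp only [mul_neg, mul_one, neg_neg, one_pow, one_smul]
  abel

theorem castDeg_pairForm (h : p = q) (Ψ : PreOmega G γ p) :
    castDeg (PreForm E₁ P₁ (𝔤 × 𝔥)) h (pairForm Ψ) =
      pairForm (castDeg (PreOmega G γ) h Ψ) := by
  subst h; rfl

theorem preBracket_jacobi (Ψ : PreOmega G γ k) (Φ : PreOmega G γ l) (Ξ : PreOmega G γ i) :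
    (-1 : ℝ) ^ (k * i) • preBracket (preBracket Ψ Φ) Ξ +
      (-1 : ℝ) ^ (l * i) • castDeg (PreOmega G γ) (by omega : i + k + l = k + l + i)
        (preBracket (preBracket Ξ Ψ) Φ) +
      (-1 : ℝ) ^ (k * l) • castDeg (PreOmega G γ) (by omega : l + i + k = k + l + i)
        (preBracket (preBracket Φ Ξ) Ψ) = 0 := by
  refine Prod.ext ?_ (Prod.ext ?_ ?_)
  · simp only [castDeg_preOmega, Prod.fst_add, Prod.smul_fst, preBracket_fst, castDeg_wedgeTo]
    exact wedgeTo_jacobi lieBracket_antisymm lieBracket_jacobi _ _ _ _ _ _ _ _ _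
  -- The graded Jacobi identity in the semidirect product, projected to its `𝔥`-part.
  · have h := congrArg (mapValues (LinearMap.snd ℝ 𝔤 𝔥)) (wedgeTo_jacobi γ.semidirect_antisymm
      γ.semidirect_jacobi (pairForm Ψ) (pairForm Φ) (pairForm Ξ) rfl rfl rfl
      (by omega : i + k + l = k + l + i) rfl (by omega : l + i + k = k + l + i))
    simp only [← pairForm_preBracket] at h
    rw [← castDeg_wedgeTo γ.semidirect _ _ rfl (by omega : i + k + l = k + l + i),
      ← castDeg_wedgeTo γ.semidirect _ _ rfl (by omega : l + i + k = k + l + i)] at h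
    simp only [← pairForm_preBracket, castDeg_pairForm, mapValues_add, mapValues_smul,
      mapValues_snd_pairForm, mapValues_zero] at h
    exact h
  · simp only [castDeg_preOmega, Prod.snd_add, Prod.smul_snd, preBracket_snd_snd, preBracket_fst,
      castDeg_sub, castDeg_smul, castDeg_wedgeTo, wedgeTo_sub_right, wedgeTo_smul_right,
      Prod.snd_zero]
    -- Each action of a bracket becomes a graded commutator of iterated actions; the resulting terms
    -- cancel in pairs with the nested ones.
    rw [wedgeTo_action γ.action_lie Ψ.1 Φ.1 Ξ.2.2 (m := l + i + 1) (m' := i + k + 1) rfl _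
        (by omega) (by omega) (by omega) (by omega),
      wedgeTo_action γ.action_lie Ξ.1 Ψ.1 Φ.2.2 (m := k + l + 1) (m' := l + i + 1) rfl _
        (by omega) (by omega) (by omega) (by omega),
      wedgeTo_action γ.action_lie Φ.1 Ξ.1 Ψ.2.2 (m := i + k + 1) (m' := k + l + 1) rfl _
        (by omega) (by omega) (by omega) (by omega)]
    simp only [add_mul, pow_add, Nat.mul_comm i l, Nat.mul_comm i k, Nat.mul_comm l k]
    rcases neg_one_pow_eq_or ℝ (k * l) with e1 | e1 <;>
      rcases neg_one_pow_eq_or ℝ (k * i) with e2 | e2 <;>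
      rcases neg_one_pow_eq_or ℝ (l * i) with e3 | e3 <;>
      rw [e1, e2, e3] <;> module

theorem preD_preBracket {Ψ : PreOmega G γ k} {Φ : PreOmega G γ l} (hΨ : Ψ ∈ Omega G γ k)
    (hΦ : Φ ∈ Omega G γ l) :
    preD (preBracket Ψ Φ) =
      castDeg (PreOmega G γ) (by omega : k + 1 + l = k + l + 1) (preBracket (preD Ψ) Φ) +
        (-1 : ℝ) ^ k • preBracket Ψ (preD Φ) := by
  have ht := pullback_t_eq hΨ
  have ht' := pullback_t_eq hΦ
  obtain ⟨h1, h2, h3, -, -⟩ := hΨ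
  obtain ⟨k1, k2, k3, -, -⟩ := hΦ
  have hs := h1.pullback G.contMDiff_s
  have hs' := k1.pullback G.contMDiff_s
  refine Prod.ext ?_ (Prod.ext ?_ ?_)
  -- The ordinary Leibniz rule, with the `t_*` terms matched by the equivariance of `t_*`.
  · simp only [castDeg_preOmega, preD, preBracket_fst, preBracket_snd_snd, Prod.fst_add,
      Prod.smul_fst, castDeg_wedgeTo, wedgeTo_sub_left, wedgeTo_sub_right, wedgeTo_smul_left,
      wedgeTo_smul_right, mapValues_sub, mapValues_smul, t_wedgeTo_action, castDeg_sub,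
      castDeg_smul]
    rw [extd_wedgeTo _ h1 k1 rfl (by omega) (by omega),
      wedgeTo_antisymm lieBracket_antisymm Φ.1 (Ψ.2.2.mapValues _)]
    simp only [pow_add, mul_add, mul_one, Nat.mul_comm l k]
    rcases neg_one_pow_eq_or ℝ (k * l) with e1 | e1 <;>
      rcases neg_one_pow_eq_or ℝ k with e2 | e2 <;>
      rcases neg_one_pow_eq_or ℝ l with e3 | e3 <;> rw [e1, e2, e3] <;> module
  -- On the left, `t^*Ψᵃ = s^*Ψᵃ + t_*Ψᵇ` produces brackets of b-parts with `t^*` of c-parts. On the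
  -- right, `Δ` of the c-parts gives the same brackets, and its `s^*` halves cancel against the
  -- action of `s^* t_*` of the c-parts.
  · simp only [castDeg_preOmega, preD, preBracket_snd_fst, preBracket_snd_snd, Prod.fst_add,
      Prod.smul_fst, Prod.snd_add, Prod.smul_snd, castDeg_wedgeTo, castDeg_add, castDeg_sub,
      castDeg_smul, LieGroupoid.delta₀, PreForm.pullback_sub, pullback_smul, pullback_wedgeTo, ht,
      ht', pullback_mapValues, wedgeTo_add_left,
      wedgeTo_sub_left, wedgeTo_sub_right, wedgeTo_smul_left, wedgeTo_smul_right,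
      wedgeTo_t_action]
    rw [extd_sub ((h2.wedgeTo _ k2 _).add (hs.wedgeTo _ k2 _)) ((hs'.wedgeTo _ h2 _).smul _),
      extd_add (h2.wedgeTo _ k2 _) (hs.wedgeTo _ k2 _), extd_smul,
      extd_wedgeTo _ h2 k2 _ (by omega) (by omega), extd_wedgeTo _ hs k2 _ (by omega) (by omega),
      extd_wedgeTo _ hs' h2 _ (by omega) (by omega), extd_pullback G.contMDiff_s h1,
      extd_pullback G.contMDiff_s k1,
      wedgeTo_antisymm lieBracket_antisymm Φ.2.1 (Ψ.2.2.pullback G.t),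
      wedgeTo_antisymm lieBracket_antisymm (Φ.2.2.pullback G.s) Ψ.2.1]
    simp only [pow_add, mul_add, add_mul, mul_one, one_mul, Nat.mul_comm l k]
    rcases neg_one_pow_eq_or ℝ (k * l) with e1 | e1 <;>
      rcases neg_one_pow_eq_or ℝ k with e2 | e2 <;>
      rcases neg_one_pow_eq_or ℝ l with e3 | e3 <;> rw [e1, e2, e3] <;> module
  -- By the Peiffer identity the terms `α_*(t_*Ψᶜ ∧ Φᶜ)` and `α_*(t_*Φᶜ ∧ Ψᶜ)` are brackets in `𝔥`,
  -- which cancel by graded antisymmetry in degrees `k + 1` and `l + 1`.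
  · simp only [castDeg_preOmega, preD, preBracket_snd_snd,
      Prod.snd_add, Prod.smul_snd, castDeg_wedgeTo, castDeg_sub,
      castDeg_smul, wedgeTo_sub_left, wedgeTo_smul_left, wedgeTo_t_action]
    rw [extd_sub (h1.wedgeTo _ k3 _) ((k1.wedgeTo _ h3 _).smul _), extd_smul,
      extd_wedgeTo _ h1 k3 _ (by omega) (by omega), extd_wedgeTo _ k1 h3 _ (by omega) (by omega),
      wedgeTo_antisymm lieBracket_antisymm Φ.2.2 Ψ.2.2]
    simp only [pow_add, mul_add, add_mul, mul_one, one_mul, Nat.mul_comm l k]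
    rcases neg_one_pow_eq_or ℝ (k * l) with e1 | e1 <;>
      rcases neg_one_pow_eq_or ℝ k with e2 | e2 <;>
      rcases neg_one_pow_eq_or ℝ l with e3 | e3 <;> rw [e1, e2, e3] <;> module

/-- The differential on `Ω^*(P, γ)`. -/
def omegaD (G : LieGroupoid E₀ P₀ E₁ P₁) (γ : Lie2Algebra 𝔥 𝔤) (p : ℕ) :
    Omega G γ p →ₗ[ℝ] Omega G γ (p + 1) where
  toFun Ψ := ⟨preD Ψ.1, preD_mem Ψ.2⟩
  map_add' Ψ Φ := Subtype.ext (preD_add Ψ.2 Φ.2)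
  map_smul' c Ψ := Subtype.ext (preD_smul c Ψ.1)

/-- The bracket on `Ω^*(P, γ)`. -/
def omegaBracket (G : LieGroupoid E₀ P₀ E₁ P₁) (γ : Lie2Algebra 𝔥 𝔤) (k l : ℕ) :
    Omega G γ k →ₗ[ℝ] Omega G γ l →ₗ[ℝ] Omega G γ (k + l) :=
  LinearMap.mk₂ ℝ (fun Ψ Φ => ⟨preBracket Ψ.1 Φ.1, preBracket_mem Ψ.2 Φ.2⟩)
    (fun Ψ Ψ' Φ => Subtype.ext (preBracket_add_left Ψ.1 Ψ'.1 Φ.1))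
    (fun c Ψ Φ => Subtype.ext (preBracket_smul_left c Ψ.1 Φ.1))
    (fun Ψ Φ Φ' => Subtype.ext (preBracket_add_right Ψ.1 Φ.1 Φ'.1))
    (fun c Ψ Φ => Subtype.ext (preBracket_smul_right c Ψ.1 Φ.1))

theorem isDGLA_omega (G : LieGroupoid E₀ P₀ E₁ P₁) (γ : Lie2Algebra 𝔥 𝔤) :
    IsDGLA (fun p => Omega G γ p) (omegaD G γ) (omegaBracket G γ) where
  D_D p Ψ := Subtype.ext (preD_preD Ψ.2)
  antisymm k l Ψ Φ := Subtype.ext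
    ((coe_castDeg_omega _ _).trans (preBracket_antisymm Ψ.1 Φ.1))
  jacobi k l i Ψ Φ Ξ := Subtype.ext (by
    refine Eq.trans ?_ (preBracket_jacobi Ψ.1 Φ.1 Ξ.1)
    simp only [Submodule.coe_add, Submodule.coe_smul, coe_castDeg_omega]
    rfl)
  leibniz k l Ψ Φ := Subtype.ext (by
    refine (preD_preBracket Ψ.2 Φ.2).trans ?_
    simp only [Submodule.coe_add, Submodule.coe_smul, coe_castDeg_omega]
    rfl)

end DGLA

end GForms

end

theorem mainTheorem6
    {E₀ P₀ E₁ P₁ : Type*}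
    [NormedAddCommGroup E₀] [NormedSpace ℝ E₀] [FiniteDimensional ℝ E₀]
    [TopologicalSpace P₀] [ChartedSpace E₀ P₀] [IsManifold 𝓘(ℝ, E₀) ∞ P₀]
    [NormedAddCommGroup E₁] [NormedSpace ℝ E₁] [FiniteDimensional ℝ E₁]
    [TopologicalSpace P₁] [ChartedSpace E₁ P₁] [IsManifold 𝓘(ℝ, E₁) ∞ P₁]
    (G : GForms.LieGroupoid E₀ P₀ E₁ P₁)
    {𝔥 𝔤 : Type*}
    [GForms.NormedLieRing 𝔥] [GForms.NormedLieAlgebra 𝔥] [FiniteDimensional ℝ 𝔥]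
    [GForms.NormedLieRing 𝔤] [GForms.NormedLieAlgebra 𝔤] [FiniteDimensional ℝ 𝔤]
    (γ : GForms.Lie2Algebra 𝔥 𝔤) :
    ∃ (D : ∀ p, GForms.Omega G γ p →ₗ[ℝ] GForms.Omega G γ (p + 1))
      (br : ∀ k l, GForms.Omega G γ k →ₗ[ℝ] GForms.Omega G γ l →ₗ[ℝ] GForms.Omega G γ (k + l)),
      (∀ (p : ℕ) (Ψ : GForms.Omega G γ p),
        (D p Ψ : GForms.PreOmega G γ (p + 1)) = GForms.preD (Ψ : GForms.PreOmega G γ p)) ∧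
      (∀ (k l : ℕ) (Ψ : GForms.Omega G γ k) (Φ : GForms.Omega G γ l),
        (br k l Ψ Φ : GForms.PreOmega G γ (k + l)) =
          GForms.preBracket (Ψ : GForms.PreOmega G γ k) (Φ : GForms.PreOmega G γ l)) ∧
      GForms.IsDGLA (fun p => GForms.Omega G γ p) D br := by
  exact ⟨GForms.omegaD G γ, GForms.omegaBracket G γ, fun _ _ => rfl, fun _ _ _ _ => rfl,
    GForms.isDGLA_omega G γ⟩
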